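/- Let $d\ge 1$ and let $\{\zeta_1(\mathbf t):\mathbf t\in[0,1]^d\}$ and $\{\zeta_2(\mathbf t):\mathbf t\in[0,1]^d\}$ be two (jointly measurable) centered Gaussian processes, possibly defined on different probability spaces, whose covariance functions $K_j(\mathbf s,\mathbf t)=E(\zeta_j(\mathbf s)\zeta_j(\mathbf t))$ belong to $L^2([0,1]^d\times[0,1]^d)$ and whose $L^2$ norms are almost surely finite, i.e. $\int_{[0,1]^d}\zeta_j^2(\mathbf t)\,d\mathbf t<\infty$ a.s., for $j=1,2$. For $j=1,2$, let $\lambda_{1,j}\ge\lambda_{2,j}\ge\dots\ge 0$ be the eigenvalues of the Karhunen–Loève expansion of $\zeta_j$: the positive eigenvalues, in non-increasing order and repeated according to multiplicity, of the Fredholm operator $$T_jh(\mathbf t)=\int_{[0,1]^d}K_j(\mathbf s,\mathbf t)h(\mathbf s)\,d\mathbf s,\qquad h\in L^2([0,1]^d),$$ where $\lambda_{k,j}=0$ whenever $T_j$ has fewer than $k$ positive eigenvalues (counted with multiplicity). Then the $L^2([0,1]^d)$ norms of $\zeta_1$ and $\zeta_2$ are identical in distribution, i.e. $$\int_{[0,1]^d}\zeta_1^2(\mathbf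 t)\,d\mathbf t\ \stackrel{\text{law}}{=}\ \int_{[0,1]^d}\zeta_2^2(\mathbf t)\,d\mathbf t,$$ if and only if $$\lambda_{k,1}=\lambda_{k,2}\quad\text{for all }k\ge 1.$$ -/

import Mathlib

open MeasureTheory ProbabilityTheory

/-- The cube `[0,1]^d`. Its `volume` is the `d`-fold product of Lebesgue measure on `[0,1]`. -/
abbrev Cube (d : ℕ) : Type := Fin d → unitInterval

/-- The space `L²([0,1]^d)` of (classes of) real square-integrable functions. -/
abbrev CubeL2 (d : ℕ) : Type := Lp ℝ 2 (volume : Measure (Cube d))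

/-- The covariance function `K(s,t) = E(ζ(s) ζ(t))` of a centered process `ζ`. -/
noncomputable def covKernel {d : ℕ} {Ω : Type*} [MeasurableSpace Ω] (P : Measure Ω)
    (ζ : Cube d → Ω → ℝ) (s t : Cube d) : ℝ :=
  ∫ ω, ζ s ω * ζ t ω ∂P

/-- The Fredholm operator with kernel `K`: `(T h)(t) = ∫ K(s,t) h(s) ds`. -/
noncomputable def fredholm {d : ℕ} (K : Cube d → Cube d → ℝ) (h : CubeL2 d) (t : Cube d) : ℝ :=
  ∫ s, K s t * h s

/-- `T h = y h` in `L²([0,1]^d)`, where `T` is the Fredholm operator with kernel `K`. -/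
def FredholmEigen {d : ℕ} (K : Cube d → Cube d → ℝ) (y : ℝ) (h : CubeL2 d) : Prop :=
  ∀ᵐ t ∂(volume : Measure (Cube d)), fredholm K h t = y * h t

/-- For `k ≥ 1`, the `k`-th largest eigenvalue of the Fredholm operator with kernel `K`, for a
square-integrable covariance function `K`, eigenvalues being counted with multiplicity: the largest
`x > 0` for which the eigenspaces of the eigenvalues `≥ x` contain `k` linearly independent
functions, and `0` (the supremum of the empty set) when there are fewer than `k` positive
eigenvalues. -/
noncomputable def klEigenvalue {d : ℕ} (K : Cube d → Cube d → ℝ) (k : ℕ) : ℝ :=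
  sSup {x : ℝ | 0 < x ∧ ∃ h : Fin k → CubeL2 d, LinearIndependent ℝ h ∧
    ∀ i, ∃ y : ℝ, x ≤ y ∧ FredholmEigen K y (h i)}

/-- The `L²([0,1]^d)` norm of the sample path `t ↦ ζ(t, ω)`, as a random variable. -/
noncomputable def pathNorm {d : ℕ} {Ω : Type*} (ζ : Cube d → Ω → ℝ) (ω : Ω) : ENNReal :=
  eLpNorm (fun t => ζ t ω) 2 (volume : Measure (Cube d))

/-- The `L²([0,1]^d)` norms of the two processes are identical in distribution. -/
def QuadEq {d : ℕ} {Ω₁ Ω₂ : Type*} [MeasurableSpace Ω₁] [MeasurableSpace Ω₂]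
    (P₁ : Measure Ω₁) (P₂ : Measure Ω₂) (ζ₁ : Cube d → Ω₁ → ℝ) (ζ₂ : Cube d → Ω₂ → ℝ) : Prop :=
  IdentDistrib (pathNorm ζ₁) (pathNorm ζ₂) P₁ P₂

/-- `ζ` is a measurable centered Gaussian process on `[0,1]^d`, with covariance function in
`L²([0,1]^d × [0,1]^d)`, and almost every sample path of `ζ` has a finite `L²([0,1]^d)` norm. -/
structure IsCenteredGaussianL2 {d : ℕ} {Ω : Type*} [MeasurableSpace Ω] (P : Measure Ω)
    (ζ : Cube d → Ω → ℝ) : Prop where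
  measurable : Measurable fun p : Cube d × Ω => ζ p.1 p.2
  gaussian : IsGaussianProcess ζ P
  centered : ∀ t, ∫ ω, ζ t ω ∂P = 0
  cov_memLp : MemLp (fun p : Cube d × Cube d => covKernel P ζ p.1 p.2) 2 volume
  path_finite : ∀ᵐ ω ∂P, pathNorm ζ ω < ⊤

/-! Expand a path in an orthonormal eigenbasis `b i` of the covariance operator, with eigenvalues `a
i`. The coordinates are jointly Gaussian and uncorrelated, hence independent `N(0, a i)`, so by
Parseval the squared norm `Q` has Laplace transform `E exp(-sQ) = ∏ (1 + 2 s a i)^(-1/2)`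
(`exists_spectrum`). The theorem then says that the law of `Q`, this function of `s`, and the
positive `a i` with multiplicity determine one another.

From law to eigenvalues: repeated differentiation of `∑ log (1 + s a i)` gives all power sums of `a
i / (1 + a i)`, which are the moments of a measure on `[0,1]`; its atoms carry the multiplicities
(`encard_eq_of_tsum_log_eq`). From eigenvalues to law: the Laplace transform at integers gives the
moments of `exp(-Q)`, again in `[0,1]` (`identDistrib_of_integral_exp_neg_eq`).

The analytic input is `E Q < ∞`, a consequence of Gaussianity and almost sure finiteness. It makes
`h ↦ ∫ ζ h` a Hilbert–Schmidt operator `A` into `L²(P)`; the Fredholm operator is `A* A`, compact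
with summable eigenvalues. -/

/-! ### Moments on `[0,1]` and recovery of a sequence from `∑ log (1 + s aᵢ)` -/

open Filter Topology Complex in
/-- Finite measures carried by `[0,1]` are determined by their moments. -/
theorem measure_ext_of_moments {μ ν : Measure ℝ} [IsFiniteMeasure μ] [IsFiniteMeasure ν]
    (hμ : ∀ᵐ x ∂μ, x ∈ Set.Icc (0 : ℝ) 1) (hν : ∀ᵐ x ∂ν, x ∈ Set.Icc (0 : ℝ) 1)
    (h : ∀ n : ℕ, ∫ x, x ^ n ∂μ = ∫ x, x ^ n ∂ν) : μ = ν := by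
  -- The moments are the coefficients of the power series of the characteristic function; `|x| ≤ 1`
  -- permits termwise integration.
  have key : ∀ (ρ : Measure ℝ) [IsFiniteMeasure ρ], (∀ᵐ x ∂ρ, x ∈ Set.Icc (0 : ℝ) 1) → ∀ t : ℝ,
      HasSum (fun n : ℕ => (t * I) ^ n / (n.factorial : ℂ) * ((∫ x, x ^ n ∂ρ : ℝ) : ℂ))
        (charFun ρ t) := by
    intro ρ _ hρ t
    have hmeas : ∀ n : ℕ, Measurable fun x : ℝ => (t * I) ^ n / (n.factorial : ℂ) * ((x ^ n : ℝ) :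
        ℂ) := by
      intro n; fun_prop
    have := hasSum_integral_of_dominated_convergence (μ := ρ)
      (F := fun (n : ℕ) (x : ℝ) => (t * I) ^ n / (n.factorial : ℂ) * ((x ^ n : ℝ) : ℂ))
      (f := fun x : ℝ => cexp (t * x * I)) (bound := fun n _ => |t| ^ n / n.factorial)
      (fun n => (hmeas n).aestronglyMeasurable) ?_ ?_ ?_ ?_
    · rw [charFun_apply_real]
      have e : (fun n : ℕ => (t * I) ^ n / (n.factorial : ℂ) * ((∫ x, x ^ n ∂ρ : ℝ) : ℂ)) =
          fun n : ℕ => ∫ x, (t * I) ^ n / (n.factorial : ℂ) * ((x ^ n : ℝ) : ℂ) ∂ρ := by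
        funext n; rw [integral_const_mul]; congr 1; exact integral_ofReal.symm
      rw [e]; exact this
    · intro n
      filter_upwards [hρ] with x hx
      rw [norm_mul, norm_div, norm_pow, norm_mul, norm_I, mul_one, Complex.norm_natCast, norm_real,
          norm_real,
        norm_pow, Real.norm_eq_abs, Real.norm_eq_abs]
      refine mul_le_of_le_one_right (by positivity) (pow_le_one₀ (abs_nonneg _) ?_)
      rw [abs_of_nonneg hx.1]; exact hx.2
    · exact ae_of_all _ fun x => Real.summable_pow_div_factorial _
    · exact integrable_const _
    · refine ae_of_all _ fun x => ?_
      have := NormedSpace.expSeries_div_hasSum_exp (𝔸 := ℂ) (t * x * I)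
      rw [← Complex.exp_eq_exp_ℂ] at this
      have e : (fun n : ℕ => (t * I) ^ n / (n.factorial : ℂ) * ((x ^ n : ℝ) : ℂ)) =
          fun n : ℕ => (t * x * I) ^ n / (n.factorial : ℂ) := by
        funext n; push_cast; ring
      rw [e]; exact this
  refine Measure.ext_of_charFun (funext fun t => ?_)
  refine (key μ hμ t).unique ?_
  simpa only [h] using key ν hν t

/-- For `s > 0` the derivative of each term is at most `a i`, a summable bound uniform in `s`. -/
theorem hasDerivAt_tsum_log {ι : Type*} {a : ι → ℝ} (ha : ∀ i, 0 ≤ a i) (hs : Summable a)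
    {s : ℝ} (h0 : 0 < s) :
    HasDerivAt (fun s => ∑' i, Real.log (1 + s * a i)) (∑' i, a i / (1 + s * a i)) s := by
  have hlog : ∀ s > 0, ∀ i, HasDerivAt (fun s => Real.log (1 + s * a i)) (a i / (1 + s * a i)) s :=
      by
    intro s hs i
    have h1 : HasDerivAt (fun s => 1 + s * a i) (a i) s := by
      simpa using ((hasDerivAt_id s).mul_const (a i)).const_add 1
    exact h1.log (by have := ha i; positivity)
  refine hasDerivAt_tsum_of_isPreconnected hs isOpen_Ioi isPreconnected_Ioi
    (fun i y hy => hlog y hy i) (fun i y hy => ?_) (Set.mem_Ioi.2 h0) ?_ (Set.mem_Ioi.2 h0)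
  · have := ha i
    have hy : 0 < y := hy
    rw [Real.norm_of_nonneg (by positivity)]
    exact div_le_self this (by nlinarith [mul_nonneg hy.le this])
  · refine Summable.of_nonneg_of_le (fun i => ?_) (fun i => ?_) (hs.mul_left s)
    · exact Real.log_nonneg (by nlinarith [mul_nonneg h0.le (ha i)])
    · have := mul_nonneg h0.le (ha i)
      have := Real.log_le_sub_one_of_pos (show 0 < 1 + s * a i by positivity)
      linarith

theorem summable_pow_of_nonneg {ι : Type*} {a : ι → ℝ} (ha : ∀ i, 0 ≤ a i) (hs : Summable a)
    (m : ℕ) : Summable fun i => a i ^ (m + 1) := by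
  refine Summable.of_nonneg_of_le (fun i => pow_nonneg (ha i) _) (fun i => ?_)
    (hs.mul_left ((∑' i, a i) ^ m))
  rw [pow_succ]
  exact mul_le_mul_of_nonneg_right
    (pow_le_pow_left₀ (ha i) (hs.le_tsum i fun j _ => ha j) m) (ha i)

/-- Each `y = a / (1 + s a)` solves `y' = -y²`, so differentiation raises the exponent by one. -/
theorem hasDerivAt_tsum_pow {ι : Type*} {a : ι → ℝ} (ha : ∀ i, 0 ≤ a i) (hs : Summable a)
    (m : ℕ) {s : ℝ} (h0 : 0 < s) :
    HasDerivAt (fun s => ∑' i, (a i / (1 + s * a i)) ^ (m + 1))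
      (∑' i, -(m + 1) * (a i / (1 + s * a i)) ^ (m + 2)) s := by
  have hle : ∀ s > 0, ∀ i, 0 ≤ a i / (1 + s * a i) ∧ a i / (1 + s * a i) ≤ a i := by
    intro s hs i
    have := ha i
    exact ⟨by positivity, div_le_self this (by nlinarith [mul_nonneg hs.le this])⟩
  refine hasDerivAt_tsum_of_isPreconnected (t := Set.Ioi 0)
    (g := fun i s => (a i / (1 + s * a i)) ^ (m + 1))
    (g' := fun i s => -((m : ℝ) + 1) * (a i / (1 + s * a i)) ^ (m + 2))
    ((summable_pow_of_nonneg ha hs (m + 1)).mul_left ((m : ℝ) + 1)) isOpen_Ioi isPreconnected_Ioi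
    (fun i y hy => ?_) (fun i y hy => ?_) (Set.mem_Ioi.2 h0) ?_ (Set.mem_Ioi.2 h0)
  · have hy : 0 < y := hy
    have h1 : HasDerivAt (fun s => 1 + s * a i) (a i) y := by
      simpa using ((hasDerivAt_id y).mul_const (a i)).const_add 1
    have hne : 1 + y * a i ≠ 0 := by have := ha i; positivity
    have h2 := (((hasDerivAt_const y (a i)).fun_div h1 hne).fun_pow (m + 1))
    refine h2.congr_deriv ?_
    rw [Nat.add_sub_cancel]
    rw [zero_mul, zero_sub, neg_div, ← sq, ← div_pow, Nat.cast_succ]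
    ring
  · have hy : 0 < y := hy
    rw [norm_mul, norm_neg, norm_pow, Real.norm_of_nonneg (by positivity),
      Real.norm_of_nonneg (hle y hy i).1]
    exact mul_le_mul_of_nonneg_left (pow_le_pow_left₀ (hle y hy i).1 (hle y hy i).2 _)
      (by positivity)
  · exact Summable.of_nonneg_of_le (fun i => pow_nonneg (hle s h0 i).1 _)
      (fun i => pow_le_pow_left₀ (hle s h0 i).1 (hle s h0 i).2 _) (summable_pow_of_nonneg ha hs m)

/-- Induction on `m`: the identity for all `s > 0` is differentiated to give the next power. -/
theorem tsum_pow_eq_of_tsum_log_eq {ι κ : Type*} {a : ι → ℝ} {b : κ → ℝ} (ha : ∀ i, 0 ≤ a i)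
    (hb : ∀ j, 0 ≤ b j) (hsa : Summable a) (hsb : Summable b)
    (h : ∀ s : ℝ, 0 < s → ∑' i, Real.log (1 + s * a i) = ∑' j, Real.log (1 + s * b j)) (m : ℕ) :
    ∀ s : ℝ, 0 < s →
      ∑' i, (a i / (1 + s * a i)) ^ (m + 1) = ∑' j, (b j / (1 + s * b j)) ^ (m + 1) := by
  induction m with
  | zero =>
    intro s hs
    simp only [zero_add, pow_one]
    refine (hasDerivAt_tsum_log ha hsa hs).unique ((hasDerivAt_tsum_log hb hsb hs).congr_of_eventuallyEq ?_)
    filter_upwards [lt_mem_nhds hs] with t ht using h t ht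
  | succ m ih =>
    intro s hs
    have := (hasDerivAt_tsum_pow ha hsa m hs).unique
      ((hasDerivAt_tsum_pow hb hsb m hs).congr_of_eventuallyEq (by
        filter_upwards [lt_mem_nhds hs] with t ht using ih t ht))
    rw [tsum_mul_left, tsum_mul_left] at this
    exact mul_left_cancel₀ (neg_ne_zero.2 (by positivity)) this

/-- The measure `∑ yᵢ δ_{yᵢ}`. -/
noncomputable def weightedDirac {ι : Type*} (y : ι → ℝ) : Measure ℝ :=
  Measure.sum fun i => ENNReal.ofReal (y i) • Measure.dirac (y i)

theorem isFiniteMeasure_weightedDirac {ι : Type*} {y : ι → ℝ} (hs : Summable y)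
    (hy : ∀ i, 0 ≤ y i) : IsFiniteMeasure (weightedDirac y) := by
  refine ⟨?_⟩
  rw [weightedDirac, Measure.sum_apply _ MeasurableSet.univ]
  simp only [Measure.smul_apply, measure_univ, smul_eq_mul, mul_one]
  rw [← ENNReal.ofReal_tsum_of_nonneg hy hs]
  exact ENNReal.ofReal_lt_top

/-- The weight `y i` keeps the total mass finite and shifts exponents by one, so the possibly
infinite zeroth power sum never occurs. -/
theorem integral_pow_weightedDirac {ι : Type*} {y : ι → ℝ} (hs : Summable y)
    (hy : ∀ i, 0 ≤ y i) (hy1 : ∀ᵐ x ∂weightedDirac y, x ∈ Set.Icc (0 : ℝ) 1) (n : ℕ) :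
    ∫ x, x ^ n ∂weightedDirac y = ∑' i, y i ^ (n + 1) := by
  have := isFiniteMeasure_weightedDirac hs hy
  have hint : Integrable (fun x : ℝ => x ^ n) (weightedDirac y) := by
    refine Integrable.of_bound (by fun_prop) 1 ?_
    filter_upwards [hy1] with x hx
    rw [norm_pow, Real.norm_of_nonneg hx.1]
    exact pow_le_one₀ hx.1 hx.2
  rw [weightedDirac] at hint ⊢
  rw [← (hasSum_integral_measure hint).tsum_eq]
  refine tsum_congr fun i => ?_
  rw [integral_smul_measure, integral_dirac, ENNReal.toReal_ofReal (hy i), smul_eq_mul, pow_succ']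

theorem weightedDirac_singleton {ι : Type*} {y : ι → ℝ} (x : ℝ) :
    weightedDirac y {x} = {i | y i = x}.encard * ENNReal.ofReal x := by
  rw [weightedDirac, Measure.sum_apply _ (measurableSet_singleton x), ← ENNReal.tsum_set_const,
    tsum_subtype {i | y i = x} fun _ => ENNReal.ofReal x]
  refine tsum_congr fun i => ?_
  by_cases hi : y i = x <;> simp [Set.indicator, hi]

/-- The map `x ↦ x / (1 + x)`, which is the case `s = 1` above, sends the terms into `[0,1]` and is
injective there, so multiplicities survive. -/
theorem div_one_add_properties {ι : Type*} {a : ι → ℝ} (ha : ∀ i, 0 ≤ a i) (hs : Summable a) :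
    (∀ i, 0 ≤ a i / (1 + a i)) ∧ Summable (fun i => a i / (1 + a i)) ∧
      (∀ᵐ x ∂weightedDirac fun i => a i / (1 + a i), x ∈ Set.Icc (0 : ℝ) 1) ∧
      ∀ x : ℝ, 0 < x → {i | a i = x} = {i | a i / (1 + a i) = x / (1 + x)} := by
  have h0 : ∀ i, 0 ≤ a i / (1 + a i) := fun i => by have := ha i; positivity
  refine ⟨h0, Summable.of_nonneg_of_le h0
    (fun i => div_le_self (ha i) (by linarith [ha i])) hs, ?_, fun x hx => ?_⟩
  · refine (Measure.ae_sum_iff' (p := fun x => x ∈ Set.Icc (0 : ℝ) 1) measurableSet_Icc).2 ?_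
    intro i
    refine Measure.ae_smul_measure ?_ _
    refine (ae_dirac_iff (p := fun x => x ∈ Set.Icc (0 : ℝ) 1) measurableSet_Icc).2 ?_
    exact ⟨h0 i, (div_le_one (by linarith [ha i])).2 (by linarith)⟩
  · ext i
    have := ha i
    change a i = x ↔ a i / (1 + a i) = x / (1 + x)
    rw [div_eq_div_iff (by positivity) (by positivity)]
    constructor <;> intro h <;> linarith

/-- The values of `∑ log (1 + s aᵢ)`, `s > 0`, determine the multiplicities of the positive
terms of the sequence `a`. -/
theorem encard_eq_of_tsum_log_eq {ι κ : Type*} {a : ι → ℝ} {b : κ → ℝ} (ha : ∀ i, 0 ≤ a i)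
    (hb : ∀ j, 0 ≤ b j) (hsa : Summable a) (hsb : Summable b)
    (h : ∀ s : ℝ, 0 < s → ∑' i, Real.log (1 + s * a i) = ∑' j, Real.log (1 + s * b j))
    {x : ℝ} (hx : 0 < x) : {i | a i = x}.encard = {j | b j = x}.encard := by
  obtain ⟨ha0, has, ha1, hax⟩ := div_one_add_properties ha hsa
  obtain ⟨hb0, hbs, hb1, hbx⟩ := div_one_add_properties hb hsb
  have := isFiniteMeasure_weightedDirac has ha0
  have := isFiniteMeasure_weightedDirac hbs hb0
  have hm := measure_ext_of_moments ha1 hb1 fun n => by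
    rw [integral_pow_weightedDirac has ha0 ha1, integral_pow_weightedDirac hbs hb0 hb1]
    simpa using tsum_pow_eq_of_tsum_log_eq ha hb hsa hsb h n 1 one_pos
  have hx' := congrArg (fun m => m {x / (1 + x)}) hm
  simp only [weightedDirac_singleton, ← hax x hx, ← hbx x hx] at hx'
  have hpos : 0 < x / (1 + x) := by positivity
  rw [ENNReal.mul_left_inj (by simpa using hpos) ENNReal.ofReal_ne_top] at hx'
  exact_mod_cast hx'

/-! ### Multiplicities, counting functions and sorted terms -/

/-- The `k`-th largest positive term of a family of real numbers (with repetitions). -/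
noncomputable def sortedTerm {ι : Type*} (a : ι → ℝ) (k : ℕ) : ℝ :=
  sSup {x : ℝ | 0 < x ∧ (k : ℕ∞) ≤ {i | x ≤ a i}.encard}

theorem finite_setOf_le_of_summable {ι : Type*} {a : ι → ℝ} (hs : Summable a) {x : ℝ}
    (hx : 0 < x) : {i | x ≤ a i}.Finite := by
  have := hs.tendsto_cofinite_zero.eventually (gt_mem_nhds hx)
  simpa [Filter.eventually_cofinite] using this

/-- Equality of multiplicities yields a bijection matching the positive terms. -/
theorem exists_equiv_of_encard_eq {ι κ : Type*} {a : ι → ℝ} {b : κ → ℝ}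
    (hsa : Summable a) (hsb : Summable b)
    (h : ∀ x : ℝ, 0 < x → {i | a i = x}.encard = {j | b j = x}.encard) :
    ∃ e : {i // 0 < a i} ≃ {j // 0 < b j}, ∀ i, b (e i) = a i := by
  -- Summability makes the fibres over `x > 0` finite, so equal cardinalities give bijections of
  -- fibres, glued below into `E`.
  have hfib : ∀ x : {x : ℝ // 0 < x},
      Nonempty ({i // a i = x} ≃ {j // b j = x}) := by
    rintro ⟨x, hx⟩
    have hfa : {i | a i = x}.Finite :=
      (finite_setOf_le_of_summable hsa hx).subset fun i hi => (show a i = x from hi).ge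
    have hfb : {j | b j = x}.Finite :=
      (finite_setOf_le_of_summable hsb hx).subset fun i hi => (show b i = x from hi).ge
    have := hfa.to_subtype
    have := hfb.to_subtype
    refine (Finite.card_eq (α := {i | a i = x}) (β := {j | b j = x})).1 ?_
    rw [Nat.card_coe_set_eq, Nat.card_coe_set_eq, Set.ncard, Set.ncard, h x hx]
  let e := fun x => (hfib x).some
  let fa : {i // 0 < a i} → {x : ℝ // 0 < x} := fun i => ⟨a i, i.2⟩
  let fb : {j // 0 < b j} → {x : ℝ // 0 < x} := fun j => ⟨b j, j.2⟩
  let E : ∀ x, {i // fa i = x} ≃ {j // fb j = x} := fun x =>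
    { toFun := fun i => ⟨⟨e x ⟨i.1.1, congrArg Subtype.val i.2⟩,
          by rw [(e x _).2]; exact x.2⟩, Subtype.ext (e x _).2⟩
      invFun := fun j => ⟨⟨(e x).symm ⟨j.1.1, congrArg Subtype.val j.2⟩,
          by rw [((e x).symm _).2]; exact x.2⟩, Subtype.ext ((e x).symm _).2⟩
      left_inv := fun i => by simp
      right_inv := fun j => by simp }
  refine ⟨Equiv.ofFiberEquiv E, fun i => ?_⟩
  exact congrArg Subtype.val (Equiv.ofFiberEquiv_map E i)

theorem tsum_eq_of_equiv {ι κ : Type*} {a : ι → ℝ} {b : κ → ℝ} (ha : ∀ i, 0 ≤ a i)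
    (hb : ∀ j, 0 ≤ b j) (e : {i // 0 < a i} ≃ {j // 0 < b j}) (he : ∀ i, b (e i) = a i)
    (f : ℝ → ℝ) (hf : f 0 = 0) : ∑' i, f (a i) = ∑' j, f (b j) := by
  rw [← tsum_subtype_eq_of_support_subset (s := {i | 0 < a i}) (f := fun i => f (a i))
    (fun i hi => (ha i).lt_of_ne fun h0 => hi (by simp [← h0, hf])),
        ← tsum_subtype_eq_of_support_subset (s := {j | 0 < b j}) (f := fun j => f (b j))
    (fun i hi => (hb i).lt_of_ne fun h0 => hi (by simp [← h0, hf]))]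
  refine Eq.trans (tsum_congr fun i => ?_) (Equiv.tsum_eq e fun j => f (b j))
  exact congrArg f (he i).symm

theorem encard_le_eq_of_equiv {ι κ : Type*} {a : ι → ℝ} {b : κ → ℝ}
    (e : {i // 0 < a i} ≃ {j // 0 < b j}) (he : ∀ i, b (e i) = a i) {x : ℝ} (hx : 0 < x) :
    {i | x ≤ a i}.encard = {j | x ≤ b j}.encard := by
  refine Set.encard_congr
    { toFun := fun i => ⟨e ⟨i.1, hx.trans_le i.2⟩, ?_⟩
      invFun := fun j => ⟨e.symm ⟨j.1, hx.trans_le j.2⟩, ?_⟩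
      left_inv := fun i => by simp
      right_inv := fun j => by simp }
  · change x ≤ b _
    rw [he]; exact i.2
  · change x ≤ a _
    rw [← he, e.apply_symm_apply]; exact j.2

/-- The sorted terms of a summable family determine its counting function. -/
theorem le_encard_iff_le_sortedTerm {ι : Type*} {a : ι → ℝ} (ha : ∀ i, 0 ≤ a i) (hs : Summable a)
    {k : ℕ} (hk : 1 ≤ k) {x : ℝ} (hx : 0 < x) :
    (k : ℕ∞) ≤ {i | x ≤ a i}.encard ↔ x ≤ sortedTerm a k := by
  set S := {x : ℝ | 0 < x ∧ (k : ℕ∞) ≤ {i | x ≤ a i}.encard} with hS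
  constructor
  · intro h
    refine le_csSup ⟨∑' i, a i, ?_⟩ (show x ∈ S from ⟨hx, h⟩)
    rintro y ⟨hy, hyk⟩
    -- This needs `k ≥ 1`: for `k = 0` the set `S` is all of `(0, ∞)`, which is unbounded.
    have : {i | y ≤ a i}.Nonempty := by
      rw [← Set.one_le_encard_iff_nonempty]
      exact le_trans (by exact_mod_cast hk) hyk
    obtain ⟨i, hi⟩ := this
    exact le_trans hi (hs.le_tsum i fun j _ => ha j)
  · intro h
    -- The supremum of the empty set is `0`, which contradicts `0 < x ≤ sortedTerm a k`.
    have hne : S.Nonempty := by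
      by_contra hne
      rw [Set.not_nonempty_iff_eq_empty] at hne
      rw [sortedTerm, ← hS, hne, Real.sSup_empty] at h
      linarith
    -- Only finitely many terms lie in `[x/2, x)`, so some `y < x` exceeds them all; a term that is
    -- at least some `z > y` is then at least `x`.
    have hfin : {i | x / 2 ≤ a i ∧ a i < x}.Finite :=
      (finite_setOf_le_of_summable hs (half_pos hx)).subset fun i hi => hi.1
    have hev : ∀ᶠ y in nhdsWithin x (Set.Iio x), x / 2 < y ∧ ∀ i ∈ {i | x / 2 ≤ a i ∧ a i < x},
        a i < y := by
      refine Filter.Eventually.and (nhdsWithin_le_nhds (lt_mem_nhds (half_lt_self hx))) ?_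
      rw [Filter.eventually_all_finite hfin]
      exact fun i hi => nhdsWithin_le_nhds (lt_mem_nhds hi.2)
    obtain ⟨y, ⟨hy2, hya⟩, hyx⟩ := (hev.and self_mem_nhdsWithin).exists
    obtain ⟨z, hz, hyz⟩ := exists_lt_of_lt_csSup hne (lt_of_lt_of_le hyx h)
    refine hz.2.trans (Set.encard_le_encard fun i hi => ?_)
    change x ≤ a i
    by_contra hlt
    have hi : z ≤ a i := hi
    exact absurd (hya i ⟨by linarith, not_le.1 hlt⟩) (by linarith)

theorem encard_le_eq_of_sortedTerm_eq {ι κ : Type*} {a : ι → ℝ} {b : κ → ℝ} (ha : ∀ i, 0 ≤ a i)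
    (hb : ∀ j, 0 ≤ b j) (hsa : Summable a) (hsb : Summable b)
    (h : ∀ k, 1 ≤ k → sortedTerm a k = sortedTerm b k) {x : ℝ} (hx : 0 < x) :
    {i | x ≤ a i}.encard = {j | x ≤ b j}.encard := by
  refine ENat.eq_of_forall_natCast_le_iff fun k => ?_
  rcases Nat.eq_zero_or_pos k with rfl | hk
  · simp
  · rw [le_encard_iff_le_sortedTerm ha hsa hk hx, le_encard_iff_le_sortedTerm hb hsb hk hx, h k hk]

theorem eventually_setOf_lt_eq {ι : Type*} {a : ι → ℝ} (hs : Summable a) {x : ℝ} (hx : 0 < x) :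
    ∀ᶠ y in nhdsWithin x (Set.Ioi x), {i | x < a i} = {i | y ≤ a i} := by
  have hfin : {i | x < a i}.Finite :=
    (finite_setOf_le_of_summable hs hx).subset fun i hi => (show x < a i from hi).le
  have hev : ∀ᶠ y in nhdsWithin x (Set.Ioi x), ∀ i ∈ {i | x < a i}, y < a i := by
    rw [Filter.eventually_all_finite hfin]
    exact fun i hi => nhdsWithin_le_nhds (gt_mem_nhds hi)
  filter_upwards [hev, self_mem_nhdsWithin] with y hy hxy
  exact Set.Subset.antisymm (fun i hi => (hy i hi).le) fun i hi =>
    (show x < a i from lt_of_lt_of_le hxy hi)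

theorem encard_setOf_le_eq_add {ι : Type*} (a : ι → ℝ) {x : ℝ} :
    {i | x ≤ a i}.encard = {i | a i = x}.encard + {i | x < a i}.encard := by
  rw [← Set.encard_union_eq]
  · congr 1; ext i
    exact (le_iff_eq_or_lt (a := x) (b := a i)).trans (or_congr_left eq_comm)
  · exact Set.disjoint_left.2 fun i (h1 : a i = x) (h2 : x < a i) => h2.ne' h1

/-- The multiplicity of `x` is the jump of the counting function at `x`, and the counts are finite,
so they can be subtracted. -/
theorem encard_eq_of_encard_le_eq {ι κ : Type*} {a : ι → ℝ} {b : κ → ℝ}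
    (hsa : Summable a) (hsb : Summable b)
    (h : ∀ x : ℝ, 0 < x → {i | x ≤ a i}.encard = {j | x ≤ b j}.encard) {x : ℝ} (hx : 0 < x) :
    {i | a i = x}.encard = {j | b j = x}.encard := by
  obtain ⟨y, ⟨hya, hyb⟩, hxy⟩ := (((eventually_setOf_lt_eq hsa hx).and
    (eventually_setOf_lt_eq hsb hx)).and self_mem_nhdsWithin).exists
  have hlt : {i | x < a i}.encard = {j | x < b j}.encard := by
    rw [hya, hyb]; exact h y (hx.trans hxy)
  have hle := h x hx
  rw [encard_setOf_le_eq_add a, encard_setOf_le_eq_add b, hlt] at hle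
  refine WithTop.add_right_cancel ?_ hle
  refine Set.encard_ne_top_iff.2 ?_
  exact (finite_setOf_le_of_summable hsb hx).subset fun i hi => (show x < b i from hi).le

-- Compact self-adjoint operators and their eigenvalue counts

universe u

/-- A compact self-adjoint operator has a Hilbert basis of eigenvectors. -/
theorem exists_hilbertBasis_eigenvectors {E : Type u} [NormedAddCommGroup E] [InnerProductSpace ℝ E]
    [CompleteSpace E] {T : E →L[ℝ] E} (hT : IsCompactOperator T) (hT' : T.IsSymmetric) :
    ∃ (ι : Type u) (b : HilbertBasis ι ℝ E) (a : ι → ℝ), ∀ i, T (b i) = a i • b i := by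
  have hfam := hT'.orthogonalFamily_eigenspaces
  have hbot := T.orthogonalComplement_iSup_eigenspaces_eq_bot hT hT'
  have hclosed : ∀ μ : ℝ, CompleteSpace (Module.End.eigenspace (T : Module.End ℝ E) μ) := by
    intro μ
    refine IsClosed.completeSpace_coe (hs := ?_)
    have : (Module.End.eigenspace (T : Module.End ℝ E) μ : Set E) = {x | T x = μ • x} := by
      ext x; exact Module.End.mem_eigenspace_iff
    rw [this]
    exact isClosed_eq T.continuous (continuous_const_smul μ)
  -- The kernel may be infinite-dimensional, so a Hilbert basis is taken in each closed eigenspace;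
  -- their union is orthonormal because eigenspaces are mutually orthogonal.
  choose w c hc using fun μ : ℝ =>
    exists_hilbertBasis ℝ (Module.End.eigenspace (T : Module.End ℝ E) μ)
  let v : (Σ μ : ℝ, w μ) → E := fun p => (c p.1 p.2 : E)
  have hv : Orthonormal ℝ v := hfam.orthonormal_sigma_orthonormal fun μ => (c μ).orthonormal
  have hvT : ∀ p, T (v p) = p.1 • v p := fun p => Module.End.mem_eigenspace_iff.1 (c p.1 p.2).2
  refine ⟨(Σ μ : ℝ, w μ), HilbertBasis.mkOfOrthogonalEqBot hv ?_, fun p => p.1, fun p => ?_⟩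
  · rw [eq_bot_iff, ← hbot]
    intro x hx
    rw [Submodule.mem_orthogonal] at hx
    rw [← Submodule.iInf_orthogonal, Submodule.mem_iInf]
    intro μ
    rw [Submodule.mem_orthogonal]
    intro u hu
    have hsum := ((c μ).hasSum_repr ⟨u, hu⟩).mapL
      ((innerSL ℝ x).comp (Module.End.eigenspace (T : Module.End ℝ E) μ).subtypeL)
    rw [real_inner_comm]
    refine hsum.unique ?_
    convert hasSum_zero with i
    have := hx (v ⟨μ, i⟩) (Submodule.subset_span ⟨_, rfl⟩)
    simp only [map_smul, smul_eq_mul]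
    refine mul_eq_zero_of_right _ ?_
    rw [real_inner_comm] at this
    exact this
  · simpa using hvT p

/-- The counting function of the eigenvalues of a diagonalizable operator. -/
theorem exists_linearIndependent_eigenvectors_iff {E : Type*} [NormedAddCommGroup E]
    [InnerProductSpace ℝ E] {T : E →L[ℝ] E} (hT : T.IsSymmetric) {ι : Type*}
    (b : HilbertBasis ι ℝ E) {a : ι → ℝ} (ha : ∀ i, T (b i) = a i • b i) {x : ℝ}
    (hfin : {i | x ≤ a i}.Finite) (k : ℕ) :
    (∃ h : Fin k → E, LinearIndependent ℝ h ∧ ∀ i, ∃ y : ℝ, x ≤ y ∧ T (h i) = y • h i) ↔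
      (k : ℕ∞) ≤ {i | x ≤ a i}.encard := by
  have hft := hfin.to_subtype
  have hcard : {i | x ≤ a i}.encard = Nat.card {i | x ≤ a i} := by
    rw [Nat.card_coe_set_eq, hfin.cast_ncard_eq]
  have := Fintype.ofFinite {i | x ≤ a i}
  rw [hcard, Nat.cast_le]
  constructor
  · rintro ⟨h, hli, hh⟩
    let W := Submodule.span ℝ (Set.range fun i : {i | x ≤ a i} => b i)
    -- By symmetry, an eigenvector with eigenvalue at least `x` is orthogonal to every `b i` with `a
    -- i < x`.
    have hmem : ∀ n, h n ∈ W := by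
      intro n
      obtain ⟨y, hxy, hy⟩ := hh n
      have hzero : ∀ i ∉ hfin.toFinset, b.repr (h n) i • b i = 0 := by
        intro i hi
        have hi' : ¬ x ≤ a i := fun h' => hi (hfin.mem_toFinset.2 h')
        rw [b.repr_apply_apply]
        have h1 := hT (b i) (h n)
        simp only [ContinuousLinearMap.coe_coe] at h1
        rw [ha, hy, real_inner_smul_left, real_inner_smul_right] at h1
        have h2 : (a i - y) * inner ℝ (b i) (h n) = 0 := by linarith
        rcases mul_eq_zero.1 h2 with h3 | h3
        · exact absurd (by linarith) hi'
        · rw [h3, zero_smul]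
      rw [(b.hasSum_repr (h n)).unique (hasSum_sum_of_ne_finset_zero hzero)]
      refine Submodule.sum_mem _ fun i hi => Submodule.smul_mem _ _ (Submodule.subset_span ?_)
      exact ⟨⟨i, hfin.mem_toFinset.1 hi⟩, rfl⟩
    have hli' : LinearIndependent ℝ (fun n => (⟨h n, hmem n⟩ : W)) :=
      LinearIndependent.of_comp W.subtype hli
    have : FiniteDimensional ℝ W := FiniteDimensional.span_of_finite ℝ (Set.finite_range _)
    have h1 := hli'.fintype_card_le_finrank
    rw [Fintype.card_fin] at h1
    rw [Nat.card_eq_fintype_card]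
    exact h1.trans (finrank_range_le_card _)
  · intro hk
    rw [Nat.card_eq_fintype_card, ← Fintype.card_fin k] at hk
    obtain ⟨f⟩ := Function.Embedding.nonempty_of_card_le hk
    exact ⟨fun n => b (f n), (b.orthonormal.linearIndependent).comp (fun n => ((f n :
        {i | x ≤ a i}) : ι))
      (Subtype.val_injective.comp f.injective), fun n => ⟨a (f n), (f n).2, ha _⟩⟩

/-- An operator that is square-summable along a Hilbert basis is compact. -/
theorem isCompactOperator_of_summable_sq {E F : Type*} [NormedAddCommGroup E]
    [InnerProductSpace ℝ E] [NormedAddCommGroup F] [InnerProductSpace ℝ F] [CompleteSpace F]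
    {ι : Type*} (b : HilbertBasis ι ℝ E) (S : E →L[ℝ] F) (hS : Summable fun i => ‖S (b i)‖ ^ 2) :
    IsCompactOperator S := by
  classical
  -- Finite-rank truncations of `S`; Cauchy–Schwarz and Bessel bound the error in operator norm by
  -- the root of the tail sum.
  let R : Finset ι → E →L[ℝ] F := fun s =>
    ∑ i ∈ s, (innerSL ℝ (b i)).smulRight (S (b i))
  have hR : ∀ s, IsCompactOperator (R s) := by
    intro s
    refine Finset.sum_induction _ (fun L : E →L[ℝ] F => IsCompactOperator L)
        (fun L M hL hM => hL.add hM)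
      isCompactOperator_zero fun i _ => ?_
    have : IsCompactOperator (innerSL ℝ (b i)) :=
      isCompactOperator_of_locallyCompactSpace_dom (innerSL ℝ (b i))
    exact this.clm_comp ((ContinuousLinearMap.id ℝ ℝ).smulRight (S (b i)))
  have hbound : ∀ s : Finset ι, ‖S - R s‖ ≤ Real.sqrt (∑' i, ‖S (b i)‖ ^ 2 - ∑ i ∈ s, ‖S
      (b i)‖ ^ 2) := by
    intro s
    refine ContinuousLinearMap.opNorm_le_bound _ (Real.sqrt_nonneg _) fun x => ?_
    have hx : HasSum (fun i => inner ℝ (b i) x • S (b i)) (S x) := by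
      simpa [b.repr_apply_apply] using (b.hasSum_repr x).mapL S
    have hRx : R s x = ∑ i ∈ s, inner ℝ (b i) x • S (b i) := by
      simp [R]
    have hlim : Filter.Tendsto (fun t : Finset ι => ∑ i ∈ t, inner ℝ (b i) x • S (b i) - R s x)
      Filter.atTop (nhds (S x - R s x)) := Filter.Tendsto.sub_const hx _
    refine le_of_tendsto hlim.norm ?_
    filter_upwards [Filter.eventually_ge_atTop s] with t hst
    rw [hRx, ← Finset.sum_sdiff hst, add_sub_cancel_right]
    calc ‖∑ i ∈ t \ s, inner ℝ (b i) x • S (b i)‖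
        ≤ ∑ i ∈ t \ s, ‖S (b i)‖ * |inner ℝ (b i) x| := by
          refine (norm_sum_le _ _).trans (Finset.sum_le_sum fun i _ => ?_)
          rw [norm_smul, Real.norm_eq_abs, mul_comm]
      _ ≤ Real.sqrt (∑ i ∈ t \ s, ‖S (b i)‖ ^ 2) * Real.sqrt (∑ i ∈ t \ s, |inner ℝ (b i) x| ^ 2) :=
          Real.sum_mul_le_sqrt_mul_sqrt _ _ _
      _ ≤ _ := by
          refine mul_le_mul (Real.sqrt_le_sqrt ?_) ?_ (Real.sqrt_nonneg _) (Real.sqrt_nonneg _)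
          · rw [le_sub_iff_add_le, Finset.sum_sdiff hst]
            exact hS.sum_le_tsum t fun _ _ => by positivity
          · refine Real.sqrt_le_iff.2 ⟨norm_nonneg _, ?_⟩
            simpa using b.orthonormal.sum_inner_products_le x (s := t \ s)
  refine isCompactOperator_of_tendsto (F := R) (l := Filter.atTop) (f := S) ?_
      (Filter.Eventually.of_forall hR)
  rw [tendsto_iff_norm_sub_tendsto_zero]
  have hz : Filter.Tendsto (fun s : Finset ι => Real.sqrt (∑' i, ‖S (b i)‖ ^ 2 - ∑ i ∈ s, ‖S
      (b i)‖ ^ 2))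
      Filter.atTop (nhds 0) := by
    have := (Real.continuous_sqrt.tendsto _).comp (Filter.Tendsto.const_sub (∑' i, ‖S (b i)‖ ^ 2)
        hS.hasSum)
    simpa [Function.comp_def] using this
  refine squeeze_zero (fun s => norm_nonneg _) (fun s => ?_) hz
  rw [norm_sub_rev]
  exact hbound s

/-! ### Gaussian moments and finiteness of the expected squared norm -/

theorem hasLaw_gaussianReal_of_centered {Ω : Type*} [MeasurableSpace Ω] {P : Measure Ω}
    {X : Ω → ℝ} (hX : HasGaussianLaw X P) (h0 : ∫ ω, X ω ∂P = 0) :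
    P.map X = gaussianReal 0 (∫ ω, X ω ^ 2 ∂P).toNNReal := by
  have := hX.map_eq_gaussianReal
  rwa [h0, variance_of_integral_eq_zero hX.aemeasurable h0] at this

theorem integral_pow_four_gaussianReal (v : NNReal) :
    ∫ x, x ^ 4 ∂gaussianReal 0 v = (v : ℝ) ^ 2 * ∫ x, x ^ 4 ∂gaussianReal 0 1 := by
  have h := gaussianReal_map_const_mul (μ := 0) (v := 1) (Real.sqrt v)
  have hv : (NNReal.mk (Real.sqrt v ^ 2) (sq_nonneg _)) * 1 = v := by
    ext; simp
  rw [mul_zero, hv] at h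
  rw [← h, integral_map (by fun_prop) (by fun_prop), ← integral_const_mul]
  refine integral_congr_ae (ae_of_all _ fun x => ?_)
  simp only [mul_pow]
  rw [show √(v : ℝ) ^ 4 = (√(v : ℝ) ^ 2) ^ 2 by ring, Real.sq_sqrt (NNReal.coe_nonneg v)]

/-- On an event of large probability, a centered Gaussian variable keeps at least half of its
second moment. -/
theorem exists_integral_sq_le_two_mul_setIntegral_sq : ∃ δ : ℝ, 0 < δ ∧
    ∀ {Ω : Type*} [MeasurableSpace Ω] (P : Measure Ω) [IsProbabilityMeasure P] (X : Ω → ℝ),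
      HasGaussianLaw X P → ∫ ω, X ω ∂P = 0 → ∀ A : Set Ω, MeasurableSet A → P.real Aᶜ ≤ δ →
        ∫ ω, X ω ^ 2 ∂P ≤ 2 * ∫ ω in A, X ω ^ 2 ∂P := by
  -- With `v = E X²`, the fourth moment is `(C - 1) v²`. Off `A`, `X² ≤ X⁴/(4Cv) + Cv`; for `P(Aᶜ) ≤
  -- 1/(4C)` each term contributes at most `v/4`.
  set C := ∫ x, x ^ 4 ∂gaussianReal 0 1 + 1 with hC
  have hC1 : 1 ≤ C := by
    have : 0 ≤ ∫ x, x ^ 4 ∂gaussianReal 0 1 := integral_nonneg fun x => by positivity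
    linarith
  refine ⟨1 / (4 * C), by positivity, ?_⟩
  intro Ω _ P _ X hX h0 A hA hPA
  set v := ∫ ω, X ω ^ 2 ∂P with hv
  have hv0 : 0 ≤ v := integral_nonneg fun x => by positivity
  rcases hv0.eq_or_lt with hv1 | hv1
  · rw [← hv1]
    have : 0 ≤ ∫ ω in A, X ω ^ 2 ∂P := integral_nonneg fun x => by positivity
    linarith
  have h4 : ∫ ω, X ω ^ 4 ∂P = v ^ 2 * (C - 1) := by
    have := integral_map (μ := P) hX.aemeasurable (f := fun x : ℝ => x ^ 4) (by fun_prop)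
    rw [← this, hasLaw_gaussianReal_of_centered hX h0, integral_pow_four_gaussianReal,
      Real.coe_toNNReal _ hv0, hC, add_sub_cancel_right]
  have hi2 : Integrable (fun ω => X ω ^ 2) P := hX.memLp_two.integrable_sq
  have hi4 : Integrable (fun ω => X ω ^ 4) P := by
    have := (hX.memLp (p := 4) (by norm_num)).integrable_norm_pow (by norm_num)
    refine this.congr (ae_of_all _ fun ω => ?_)
    simp only [Real.norm_eq_abs]
    exact (show Even 4 by decide).pow_abs _
  have hpt : ∀ ω, X ω ^ 2 ≤ A.indicator (fun ω => X ω ^ 2) ω +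
      (X ω ^ 4 / (4 * C * v) + C * v * Aᶜ.indicator (fun _ => (1 : ℝ)) ω) := by
    intro ω
    by_cases hω : ω ∈ A
    · simp only [Set.indicator_of_mem hω, Set.indicator_of_notMem (Set.notMem_compl_iff.2 hω),
        mul_zero, add_zero]
      have : 0 ≤ X ω ^ 4 / (4 * C * v) := by positivity
      linarith
    · simp only [Set.indicator_of_notMem hω, Set.indicator_of_mem (Set.mem_compl hω), mul_one,
        zero_add]
      have h1 : X ω ^ 4 / (4 * C * v) + C * v - X ω ^ 2 =
          (X ω ^ 2 - 2 * C * v) ^ 2 / (4 * C * v) := by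
        field_simp; ring
      have : 0 ≤ (X ω ^ 2 - 2 * C * v) ^ 2 / (4 * C * v) := by positivity
      linarith
  have hind : Integrable (Aᶜ.indicator fun _ : Ω => (1 : ℝ)) P :=
    (integrable_const 1).indicator hA.compl
  have hint := integral_mono hi2 ((hi2.indicator hA).add
    ((hi4.div_const (4 * C * v)).add (hind.const_mul (C * v)))) hpt
  have e1 := integral_add (hi2.indicator hA) ((hi4.div_const (4 * C * v)).add (hind.const_mul
      (C * v)))
  have e2 := integral_add (hi4.div_const (4 * C * v)) (hind.const_mul (C * v))
  simp only [Pi.add_apply] at hint e1 e2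
  rw [e1, e2, integral_indicator hA, integral_div, h4, integral_const_mul,
    integral_indicator_const _ hA.compl, smul_eq_mul, mul_one] at hint
  have h5 : v ^ 2 * (C - 1) / (4 * C * v) ≤ v / 4 := by
    rw [div_le_div_iff₀ (by positivity) (by norm_num)]
    nlinarith [mul_pos hv1 hv1]
  have h6 : C * v * P.real Aᶜ ≤ v / 4 := by
    calc C * v * P.real Aᶜ ≤ C * v * (1 / (4 * C)) := by gcongr
      _ = v / 4 := by field_simp
  linarith

section GaussianProcess

variable {d : ℕ} {Ω : Type*} [MeasurableSpace Ω] {P : Measure Ω} {ζ : Cube d → Ω → ℝ}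

omit [MeasurableSpace Ω] in
theorem pathNorm_sq (ω : Ω) : pathNorm ζ ω ^ 2 = ∫⁻ t, ENNReal.ofReal (ζ t ω ^ 2) := by
  rw [pathNorm, ← ENNReal.rpow_natCast]
  have := eLpNorm_nnreal_pow_eq_lintegral (f := fun t => ζ t ω) (μ := (volume : Measure (Cube d)))
    (p := 2) two_ne_zero
  simp only [ENNReal.coe_ofNat, NNReal.coe_ofNat, Nat.cast_ofNat] at this ⊢
  rw [this]
  refine lintegral_congr fun t => ?_
  rw [← ofReal_norm, ENNReal.rpow_ofNat, ← ENNReal.ofReal_pow (norm_nonneg _), Real.norm_eq_abs,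
      sq_abs]

theorem measurable_pathNorm (hm : Measurable fun p : Cube d × Ω => ζ p.1 p.2) :
    Measurable (pathNorm ζ) := by
  have h1 : Measurable fun ω => pathNorm ζ ω ^ 2 := by
    simp only [pathNorm_sq]
    exact Measurable.lintegral_prod_left' (f := fun p : Cube d × Ω => ENNReal.ofReal
        (ζ p.1 p.2 ^ 2))
      (hm.pow_const 2).ennreal_ofReal
  have h2 : pathNorm ζ = fun ω => (pathNorm ζ ω ^ 2) ^ (1 / 2 : ℝ) := by
    funext ω
    rw [← ENNReal.rpow_natCast, ← ENNReal.rpow_mul]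
    norm_num
  rw [h2]
  exact h1.pow_const _

/-- The expected squared norm of a Gaussian process with square-integrable paths is finite. -/
theorem IsCenteredGaussianL2.lintegral_pathNorm_sq_lt_top [IsProbabilityMeasure P]
    (hζ : IsCenteredGaussianL2 P ζ) : ∫⁻ ω, pathNorm ζ ω ^ 2 ∂P < ⊤ := by
  obtain ⟨δ, hδ, hδP⟩ := exists_integral_sq_le_two_mul_setIntegral_sq
  have hmeas := measurable_pathNorm hζ.measurable
  have hA : ∃ M : ℕ, P.real {ω | pathNorm ζ ω ^ 2 ≤ M}ᶜ ≤ δ := by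
    have hm : Monotone fun M : ℕ => {ω | pathNorm ζ ω ^ 2 ≤ M} := fun M N hMN ω hω =>
      le_trans (show pathNorm ζ ω ^ 2 ≤ M from hω) (by exact_mod_cast hMN)
    have hU : P (⋃ M : ℕ, {ω | pathNorm ζ ω ^ 2 ≤ M}) = 1 := by
      rw [← prob_compl_eq_zero_iff
        (MeasurableSet.iUnion fun M => measurableSet_le (hmeas.pow_const 2) measurable_const)]
      have h0 : P {ω | ¬ pathNorm ζ ω < ⊤} = 0 := hζ.path_finite
      refine measure_mono_null (t := {ω | ¬ pathNorm ζ ω < ⊤}) (fun ω hω => fun hfin => hω ?_) h0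
      obtain ⟨M, hM⟩ := ENNReal.exists_nat_gt (ENNReal.pow_lt_top hfin (n := 2)).ne
      exact Set.mem_iUnion.2 ⟨M, hM.le⟩
    have ht := (ENNReal.tendsto_toReal (by simp)).comp (tendsto_measure_iUnion_atTop (μ := P) hm)
    rw [hU] at ht
    obtain ⟨M, hM⟩ := (ht.eventually (lt_mem_nhds (show 1 - δ < (1 :
        ENNReal).toReal by simpa))).exists
    refine ⟨M, ?_⟩
    rw [probReal_compl_eq_one_sub (measurableSet_le (hmeas.pow_const 2) measurable_const)]
    have hM : 1 - δ < P.real {ω | pathNorm ζ ω ^ 2 ≤ M} := hM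
    linarith
  obtain ⟨M, hM⟩ := hA
  set A := {ω | pathNorm ζ ω ^ 2 ≤ M} with hAdef
  have hAm : MeasurableSet A := measurableSet_le (hmeas.pow_const 2) measurable_const
  have hjm : Measurable fun p : Cube d × Ω => ENNReal.ofReal (ζ p.1 p.2 ^ 2) :=
    (hζ.measurable.pow_const 2).ennreal_ofReal
  -- Since `δ` is universal, one event `A` serves every `t`; integration over `t` then bounds the
  -- expectation by `2 M`.
  have hpt : ∀ t, ∫⁻ ω, ENNReal.ofReal (ζ t ω ^ 2) ∂P ≤
      2 * ∫⁻ ω in A, ENNReal.ofReal (ζ t ω ^ 2) ∂P := by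
    intro t
    have hG := hζ.gaussian.hasGaussianLaw_eval t
    have hi : Integrable (fun ω => ζ t ω ^ 2) P := hG.memLp_two.integrable_sq
    rw [← ofReal_integral_eq_lintegral_ofReal hi (ae_of_all _ fun ω => sq_nonneg _),
      ← ofReal_integral_eq_lintegral_ofReal hi.restrict (ae_of_all _ fun ω => sq_nonneg _),
      ← ENNReal.ofReal_ofNat 2, ← ENNReal.ofReal_mul (by norm_num)]
    exact ENNReal.ofReal_le_ofReal (hδP P _ hG (hζ.centered t) A hAm hM)
  calc ∫⁻ ω, pathNorm ζ ω ^ 2 ∂P = ∫⁻ t, ∫⁻ ω, ENNReal.ofReal (ζ t ω ^ 2) ∂P := by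
        simp only [pathNorm_sq]
        exact lintegral_lintegral_swap (f := fun ω t => ENNReal.ofReal (ζ t ω ^ 2))
          (hjm.comp measurable_swap).aemeasurable
    _ ≤ ∫⁻ t, 2 * ∫⁻ ω in A, ENNReal.ofReal (ζ t ω ^ 2) ∂P := lintegral_mono hpt
    _ = 2 * ∫⁻ ω in A, pathNorm ζ ω ^ 2 ∂P := by
        rw [lintegral_const_mul' _ _ (by norm_num)]
        simp only [pathNorm_sq]
        congr 1
        exact lintegral_lintegral_swap (f := fun t ω => ENNReal.ofReal (ζ t ω ^ 2))
          hjm.aemeasurable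
    _ ≤ 2 * ∫⁻ ω in A, M ∂P := by
        gcongr 2 * ?_
        exact setLIntegral_mono measurable_const fun ω hω => hω
    _ < ⊤ := by
        rw [setLIntegral_const]
        exact ENNReal.mul_lt_top (by norm_num) (ENNReal.mul_lt_top (by simp) (measure_lt_top _ _))

end GaussianProcess

/-! ### The pairing operator and the covariance operator -/

theorem real_inner_eq_product (x y : ℝ) : inner ℝ x y = x * y := by
  simp [mul_comm]

section GaussianProcess

variable {d : ℕ} {Ω : Type*} [MeasurableSpace Ω] {P : Measure Ω} {ζ : Cube d → Ω → ℝ}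

/-- The pairing `∫ ζ(t) h(t) dt` of a sample path with a square-integrable function. -/
noncomputable def pathIntegral (ζ : Cube d → Ω → ℝ) (h : CubeL2 d) (ω : Ω) : ℝ :=
  ∫ t, ζ t ω * h t

omit [MeasurableSpace Ω] in
theorem pathIntegral_eq_inner {ω : Ω}
    (hω : MemLp (fun t => ζ t ω) 2 (volume : Measure (Cube d))) (h : CubeL2 d) :
    pathIntegral ζ h ω = inner ℝ (hω.toLp _) h := by
  rw [L2.inner_def, pathIntegral]
  refine integral_congr_ae ?_
  filter_upwards [hω.coeFn_toLp] with t ht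
  rw [ht, real_inner_eq_product]

theorem measurable_pathIntegral (hm : Measurable fun p : Cube d × Ω => ζ p.1 p.2) (h : CubeL2 d) :
    Measurable (pathIntegral ζ h) := by
  have : StronglyMeasurable fun p : Cube d × Ω => ζ p.1 p.2 * h p.1 :=
    hm.stronglyMeasurable.mul ((Lp.stronglyMeasurable h).comp_measurable measurable_fst)
  exact (this.integral_prod_left' (μ := (volume : Measure (Cube d)))).measurable

namespace IsCenteredGaussianL2

theorem ae_memLp (hζ : IsCenteredGaussianL2 P ζ) :
    ∀ᵐ ω ∂P, MemLp (fun t => ζ t ω) 2 (volume : Measure (Cube d)) := by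
  filter_upwards [hζ.path_finite] with ω hω
  exact ⟨(hζ.measurable.comp (measurable_id.prodMk measurable_const)).aestronglyMeasurable, hω⟩

theorem memLp_pathNorm [IsProbabilityMeasure P] (hζ : IsCenteredGaussianL2 P ζ) :
    MemLp (fun ω => (pathNorm ζ ω).toReal) 2 P := by
  have hm := (measurable_pathNorm hζ.measurable).ennreal_toReal
  refine ⟨hm.aestronglyMeasurable, ?_⟩
  have h1 := eLpNorm_nnreal_pow_eq_lintegral (f := fun ω => (pathNorm ζ ω).toReal) (μ := P)
    (p := 2) two_ne_zero
  have h2 : ∫⁻ ω, ‖(pathNorm ζ ω).toReal‖ₑ ^ ((2 : NNReal) : ℝ) ∂P ≤ ∫⁻ ω, pathNorm ζ ω ^ 2 ∂P := by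
    refine lintegral_mono fun ω => ?_
    rw [Real.enorm_eq_ofReal ENNReal.toReal_nonneg]
    simp only [NNReal.coe_ofNat, ENNReal.rpow_ofNat]
    gcongr
    exact ENNReal.ofReal_toReal_le
  rw [← h1] at h2
  have h3 := h2.trans_lt hζ.lintegral_pathNorm_sq_lt_top
  by_contra hc
  rw [not_lt, top_le_iff] at hc
  simp [hc] at h3

theorem abs_pathIntegral_le (hζ : IsCenteredGaussianL2 P ζ) (h : CubeL2 d) :
    ∀ᵐ ω ∂P, |pathIntegral ζ h ω| ≤ ‖h‖ * |(pathNorm ζ ω).toReal| := by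
  filter_upwards [hζ.ae_memLp] with ω hω
  rw [pathIntegral_eq_inner hω, abs_of_nonneg ENNReal.toReal_nonneg, mul_comm]
  refine (abs_real_inner_le_norm _ _).trans ?_
  rw [Lp.norm_toLp]
  rfl

theorem memLp_pathIntegral [IsProbabilityMeasure P] (hζ : IsCenteredGaussianL2 P ζ)
    (h : CubeL2 d) : MemLp (pathIntegral ζ h) 2 P :=
  hζ.memLp_pathNorm.of_le_mul (measurable_pathIntegral hζ.measurable h).aestronglyMeasurable
    (hζ.abs_pathIntegral_le h)

/-- The exceptional null set does not depend on `h`, so identities between several pairings hold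
simultaneously. -/
theorem ae_pathIntegral_linear (hζ : IsCenteredGaussianL2 P ζ) :
    ∀ᵐ ω ∂P, ∃ x : CubeL2 d, ‖x‖ = (pathNorm ζ ω).toReal ∧
      ∀ h, pathIntegral ζ h ω = inner ℝ x h := by
  filter_upwards [hζ.ae_memLp] with ω hω
  exact ⟨hω.toLp _, Lp.norm_toLp _ _, pathIntegral_eq_inner hω⟩

/-- The operator `h ↦ ∫ ζ(t) h(t) dt` from `L²([0,1]^d)` to `L²(P)`. -/
noncomputable def pairing [IsProbabilityMeasure P] (hζ : IsCenteredGaussianL2 P ζ) :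
    CubeL2 d →L[ℝ] Lp ℝ 2 P :=
  LinearMap.mkContinuous
    { toFun := fun h => (hζ.memLp_pathIntegral h).toLp _
      map_add' := fun g h => by
        rw [← MemLp.toLp_add, MemLp.toLp_eq_toLp_iff]
        filter_upwards [hζ.ae_pathIntegral_linear] with ω ⟨x, _, hx⟩
        simp [hx, inner_add_right]
      map_smul' := fun c h => by
        rw [RingHom.id_apply, ← MemLp.toLp_const_smul, MemLp.toLp_eq_toLp_iff]
        filter_upwards [hζ.ae_pathIntegral_linear] with ω ⟨x, _, hx⟩
        simp [hx, inner_smul_right] }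
    ‖hζ.memLp_pathNorm.toLp _‖ (fun h => by
      rw [mul_comm]
      refine Lp.norm_le_mul_norm_of_ae_le_mul ?_
      filter_upwards [hζ.abs_pathIntegral_le h, (hζ.memLp_pathIntegral h).coeFn_toLp,
        hζ.memLp_pathNorm.coeFn_toLp] with ω h1 h2 h3
      simp only [LinearMap.coe_mk, AddHom.coe_mk]
      rw [h2, h3]
      exact h1)

theorem coeFn_pairing [IsProbabilityMeasure P] (hζ : IsCenteredGaussianL2 P ζ) (h : CubeL2 d) :
    hζ.pairing h =ᵐ[P] pathIntegral ζ h := (hζ.memLp_pathIntegral h).coeFn_toLp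

theorem ae_hasSum_sq_pathIntegral (hζ : IsCenteredGaussianL2 P ζ) {ι : Type*}
    (b : HilbertBasis ι ℝ (CubeL2 d)) :
    ∀ᵐ ω ∂P, HasSum (fun i => pathIntegral ζ (b i) ω ^ 2) ((pathNorm ζ ω).toReal ^ 2) := by
  filter_upwards [hζ.ae_pathIntegral_linear] with ω ⟨x, hx, hi⟩
  rw [← hx, ← real_inner_self_eq_norm_sq]
  have h1 : (fun i => pathIntegral ζ (b i) ω ^ 2) = fun i => inner ℝ x (b i) * inner ℝ (b i) x := by
    funext i
    rw [hi, sq, real_inner_comm x (b i)]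
  rw [h1]
  exact b.hasSum_inner_mul_inner x x

theorem norm_sq_pairing [IsProbabilityMeasure P] (hζ : IsCenteredGaussianL2 P ζ) (h : CubeL2 d) :
    ‖hζ.pairing h‖ ^ 2 = ∫ ω, pathIntegral ζ h ω ^ 2 ∂P := by
  rw [← real_inner_self_eq_norm_sq, L2.inner_def]
  refine integral_congr_ae ?_
  filter_upwards [hζ.coeFn_pairing h] with ω hω
  rw [hω, real_inner_eq_product, sq]

/-- The Hilbert–Schmidt property: finite partial sums are expectations of Bessel sums, bounded by
the expected squared norm. -/
theorem summable_norm_sq_pairing [IsProbabilityMeasure P] (hζ : IsCenteredGaussianL2 P ζ)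
    {ι : Type*} (b : HilbertBasis ι ℝ (CubeL2 d)) : Summable fun i => ‖hζ.pairing (b i)‖ ^ 2 := by
  refine summable_of_sum_le (c := ∫ ω, (pathNorm ζ ω).toReal ^ 2 ∂P) (fun i => by positivity)
    fun s => ?_
  simp only [norm_sq_pairing]
  rw [← integral_finsetSum _ fun i _ => (hζ.memLp_pathIntegral (b i)).integrable_sq]
  refine integral_mono_ae (integrable_finsetSum _ fun i _ => (hζ.memLp_pathIntegral
      (b i)).integrable_sq)
    hζ.memLp_pathNorm.integrable_sq ?_
  filter_upwards [hζ.ae_hasSum_sq_pathIntegral b] with ω hω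
  exact sum_le_hasSum s (fun i _ => sq_nonneg _) hω

theorem memLp_prod [IsProbabilityMeasure P] (hζ : IsCenteredGaussianL2 P ζ) :
    MemLp (fun p : Cube d × Ω => ζ p.1 p.2) 2 ((volume : Measure (Cube d)).prod P) := by
  rw [memLp_two_iff_integrable_sq hζ.measurable.aestronglyMeasurable]
  refine ⟨(hζ.measurable.pow_const 2).aestronglyMeasurable, ?_⟩
  rw [hasFiniteIntegral_iff_ofReal (ae_of_all _ fun p => sq_nonneg _)]
  rw [lintegral_prod_symm' _ (hζ.measurable.pow_const 2).ennreal_ofReal]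
  simpa only [pathNorm_sq] using hζ.lintegral_pathNorm_sq_lt_top

theorem integrable_prod_mul [IsProbabilityMeasure P] (hζ : IsCenteredGaussianL2 P ζ)
    (h : CubeL2 d) {Y : Ω → ℝ} (hY : MemLp Y 2 P) :
    Integrable (fun p : Cube d × Ω => ζ p.1 p.2 * (h p.1 * Y p.2))
      ((volume : Measure (Cube d)).prod P) := by
  have h1 : MemLp (fun p : Cube d × Ω => h p.1 * Y p.2) 2 ((volume : Measure (Cube d)).prod P) := by
    rw [memLp_two_iff_integrable_sq]
    · simp only [mul_pow]
      exact (Lp.memLp h).integrable_sq.mul_prod hY.integrable_sq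
    · exact ((Lp.aestronglyMeasurable h).comp_fst).mul hY.1.comp_snd
  exact hζ.memLp_prod.integrable_mul h1

/-- Fubini's theorem for the pairing of the process with a function and a random variable. -/
theorem integral_mul_pathIntegral [IsProbabilityMeasure P] (hζ : IsCenteredGaussianL2 P ζ)
    (h : CubeL2 d) {Y : Ω → ℝ} (hY : MemLp Y 2 P) :
    ∫ ω, Y ω * pathIntegral ζ h ω ∂P = ∫ t, h t * ∫ ω, Y ω * ζ t ω ∂P := by
  have := integral_integral_swap (f := fun (t : Cube d) (ω : Ω) => ζ t ω * (h t * Y ω))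
    (hζ.integrable_prod_mul h hY)
  calc ∫ ω, Y ω * pathIntegral ζ h ω ∂P = ∫ ω, (∫ t, ζ t ω * (h t * Y ω)) ∂P := by
        refine integral_congr_ae (ae_of_all _ fun ω => ?_)
        simp only [pathIntegral]
        rw [← integral_const_mul]
        congr 1; funext t; ring
    _ = ∫ t, ∫ ω, ζ t ω * (h t * Y ω) ∂P := this.symm
    _ = _ := by
        refine integral_congr_ae (ae_of_all _ fun t => ?_)
        simp only
        rw [← integral_const_mul]
        congr 1; funext ω; ring

theorem memLp_eval (hζ : IsCenteredGaussianL2 P ζ) (t : Cube d) : MemLp (ζ t) 2 P :=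
  (hζ.gaussian.hasGaussianLaw_eval t).memLp_two

theorem fredholm_eq [IsProbabilityMeasure P] (hζ : IsCenteredGaussianL2 P ζ) (h : CubeL2 d)
    (t : Cube d) :
    fredholm (covKernel P ζ) h t = ∫ ω, pathIntegral ζ h ω * ζ t ω ∂P := by
  have := hζ.integral_mul_pathIntegral h (hζ.memLp_eval t)
  simp only [mul_comm (ζ t _)] at this
  rw [this, fredholm]
  refine integral_congr_ae (ae_of_all _ fun s => ?_)
  exact mul_comm _ _

/-- The covariance operator of the process. -/
noncomputable def covOp [IsProbabilityMeasure P] (hζ : IsCenteredGaussianL2 P ζ) :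
    CubeL2 d →L[ℝ] CubeL2 d := (ContinuousLinearMap.adjoint hζ.pairing).comp hζ.pairing

theorem inner_covOp [IsProbabilityMeasure P] (hζ : IsCenteredGaussianL2 P ζ) (g h : CubeL2 d) :
    inner ℝ g (hζ.covOp h) = inner ℝ (hζ.pairing g) (hζ.pairing h) := by
  rw [covOp, ContinuousLinearMap.comp_apply]
  exact ContinuousLinearMap.adjoint_inner_right hζ.pairing g (hζ.pairing h)

theorem inner_pairing [IsProbabilityMeasure P] (hζ : IsCenteredGaussianL2 P ζ) (g h : CubeL2 d) :
    inner ℝ (hζ.pairing g) (hζ.pairing h) = ∫ ω, pathIntegral ζ g ω * pathIntegral ζ h ω ∂P := by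
  rw [L2.inner_def]
  refine integral_congr_ae ?_
  filter_upwards [hζ.coeFn_pairing g, hζ.coeFn_pairing h] with ω h1 h2
  rw [h1, h2, real_inner_eq_product]

/-- Both sides have the same integral over every measurable set: pair `A* A h` with an indicator and
apply Fubini. -/
theorem covOp_ae_eq_fredholm [IsProbabilityMeasure P] (hζ : IsCenteredGaussianL2 P ζ)
    (h : CubeL2 d) : hζ.covOp h =ᵐ[volume] fredholm (covKernel P ζ) h := by
  have hone : MemLp (fun _ : Cube d => (1 : ℝ)) 2 (volume : Measure (Cube d)) := memLp_const 1
  have hint : Integrable (fredholm (covKernel P ζ) h) (volume : Measure (Cube d)) := by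
    have h1 := (hζ.integrable_prod_mul (hone.toLp _) (hζ.memLp_pathIntegral h)).integral_prod_left
    refine h1.congr ?_
    filter_upwards [hone.coeFn_toLp] with t ht
    rw [hζ.fredholm_eq, ht]
    congr 1; funext ω; ring
  refine Integrable.ae_eq_of_forall_setIntegral_eq _ _ ((Lp.memLp _).integrable (by norm_num)) hint
    fun s hs _ => ?_
  have hs2 : MemLp (s.indicator fun _ : Cube d => (1 : ℝ)) 2 (volume : Measure (Cube d)) :=
    hone.indicator hs
  have h1 := hζ.inner_covOp (hs2.toLp _) h
  have h2 := hζ.integral_mul_pathIntegral (hs2.toLp _) (hζ.memLp_pathIntegral h)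
  rw [real_inner_comm (hζ.pairing h), inner_pairing, h2, L2.inner_def] at h1
  simp only [← hζ.fredholm_eq] at h1
  rw [← integral_indicator hs, ← integral_indicator hs]
  refine Eq.trans (integral_congr_ae ?_) (h1.trans (integral_congr_ae ?_))
  · filter_upwards [hs2.coeFn_toLp] with t ht
    rw [ht]
    by_cases hts : t ∈ s <;> simp [hts]
  · filter_upwards [hs2.coeFn_toLp] with t ht
    rw [ht]
    by_cases hts : t ∈ s <;> simp [hts]

theorem fredholmEigen_iff [IsProbabilityMeasure P] (hζ : IsCenteredGaussianL2 P ζ) (y : ℝ)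
    (h : CubeL2 d) : FredholmEigen (covKernel P ζ) y h ↔ hζ.covOp h = y • h := by
  rw [Lp.ext_iff, FredholmEigen]
  have h1 := hζ.covOp_ae_eq_fredholm h
  have h2 := Lp.coeFn_smul y h
  constructor
  · intro hh
    filter_upwards [h1, h2, hh] with t h1 h2 h3
    rw [h1, h2, h3]; rfl
  · intro hh
    filter_upwards [h1, h2, hh] with t h1 h2 h3
    rw [← h1, h3, h2]; rfl

theorem isSymmetric_covOp [IsProbabilityMeasure P] (hζ : IsCenteredGaussianL2 P ζ) :
    hζ.covOp.IsSymmetric := fun g h => by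
  simp only [ContinuousLinearMap.coe_coe]
  rw [inner_covOp, real_inner_comm, inner_covOp, real_inner_comm]

theorem isCompactOperator_covOp [IsProbabilityMeasure P] (hζ : IsCenteredGaussianL2 P ζ) :
    IsCompactOperator hζ.covOp := by
  obtain ⟨w, b, -⟩ := exists_hilbertBasis ℝ (CubeL2 d)
  exact (isCompactOperator_of_summable_sq b hζ.pairing (hζ.summable_norm_sq_pairing b)).clm_comp
    (ContinuousLinearMap.adjoint hζ.pairing)

end IsCenteredGaussianL2

end GaussianProcess

/-- Orthonormal families in a separable space are countable. -/
theorem countable_of_orthonormal {E : Type*} [NormedAddCommGroup E] [InnerProductSpace ℝ E]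
    [TopologicalSpace.SeparableSpace E] {ι : Type*} {v : ι → E} (hv : Orthonormal ℝ v) :
    Countable ι := by
  refine Pairwise.countable_of_isOpen_disjoint (s := fun i => Metric.ball (v i) (1 / 2)) ?_
    (fun i => Metric.isOpen_ball) fun i => Metric.nonempty_ball.2 (by norm_num)
  intro i j hij
  refine Metric.ball_disjoint_ball ?_
  have h2 : ‖v i - v j‖ ^ 2 = 2 := by
    rw [norm_sub_sq_real, hv.1 i, hv.1 j, hv.2 hij]; norm_num
  rw [dist_eq_norm]
  nlinarith [norm_nonneg (v i - v j)]

/-! ### Gaussianity of the pairings -/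

theorem norm_exp_mul_I_sub_le (x y : ℝ) :
    ‖Complex.exp (x * Complex.I) - Complex.exp (y * Complex.I)‖ ≤ |x - y| := by
  have h : Complex.exp (x * Complex.I) - Complex.exp (y * Complex.I) =
      Complex.exp (y * Complex.I) * (Complex.exp (Complex.I * ((x - y : ℝ) : ℂ)) - 1) := by
    rw [mul_sub, ← Complex.exp_add, mul_one]
    congr 2
    push_cast; ring
  rw [h, norm_mul, Complex.norm_exp_ofReal_mul_I, one_mul]
  simpa using Real.norm_exp_I_mul_ofReal_sub_one_le (x := x - y)

section GaussianSpace

variable {Ω : Type*} [MeasurableSpace Ω] (P : Measure Ω)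

/-- The classes in `L²(P)` of centered Gaussian variables. -/
def centeredGaussianSet : Set (Lp ℝ 2 P) :=
  {Y | ∀ u : ℝ, ∫ ω, Complex.exp ((u * Y ω : ℝ) * Complex.I) ∂P =
    Complex.exp (-(u ^ 2 * ‖Y‖ ^ 2 / 2 : ℝ))}

variable {P}

/-- The map is Lipschitz with constant `|u|`, since the `L¹` norm is at most the `L²` norm on a
probability space. -/
theorem continuous_integral_exp_mul_I [IsProbabilityMeasure P] (u : ℝ) :
    Continuous fun Y : Lp ℝ 2 P => ∫ ω, Complex.exp ((u * Y ω : ℝ) * Complex.I) ∂P := by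
  have hint : ∀ Y : Lp ℝ 2 P,
      Integrable (fun ω => Complex.exp ((u * Y ω : ℝ) * Complex.I)) P := by
    intro Y
    refine Integrable.of_bound ?_ 1 (ae_of_all _ fun ω => by rw [Complex.norm_exp_ofReal_mul_I])
    have hY := (Lp.stronglyMeasurable Y).measurable
    have : Measurable fun ω => Complex.exp ((u * Y ω : ℝ) * Complex.I) := by fun_prop
    exact this.aestronglyMeasurable
  refine (LipschitzWith.of_dist_le_mul (K := ‖u‖₊) fun Y Z => ?_).continuous
  rw [dist_eq_norm, dist_eq_norm, ← integral_sub (hint Y) (hint Z)]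
  have h2 : MemLp (fun ω => (Y - Z : Lp ℝ 2 P) ω) 2 P := Lp.memLp _
  calc ‖∫ ω, (Complex.exp ((u * Y ω : ℝ) * Complex.I) -
          Complex.exp ((u * Z ω : ℝ) * Complex.I)) ∂P‖
      ≤ ∫ ω, |u| * ‖(Y - Z : Lp ℝ 2 P) ω‖ ∂P := by
        refine norm_integral_le_of_norm_le ((h2.integrable (by norm_num)).norm.const_mul _) ?_
        filter_upwards [Lp.coeFn_sub Y Z] with ω hω
        refine (norm_exp_mul_I_sub_le _ _).trans_eq ?_
        rw [hω, Pi.sub_apply, ← mul_sub, abs_mul, Real.norm_eq_abs]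
    _ = |u| * (eLpNorm (fun ω => (Y - Z : Lp ℝ 2 P) ω) 1 P).toReal := by
        rw [integral_const_mul, integral_norm_eq_lintegral_enorm h2.1,
            eLpNorm_one_eq_lintegral_enorm]
    _ ≤ ‖u‖₊ * ‖Y - Z‖ := by
        rw [coe_nnnorm, Real.norm_eq_abs, Lp.norm_def]
        gcongr
        · exact h2.2.ne
        · exact eLpNorm_le_eLpNorm_of_exponent_le (by norm_num) h2.1

theorem isClosed_centeredGaussianSet [IsProbabilityMeasure P] :
    IsClosed (centeredGaussianSet P) := by
  have : centeredGaussianSet P = ⋂ u : ℝ, {Y : Lp ℝ 2 P |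
      ∫ ω, Complex.exp ((u * Y ω : ℝ) * Complex.I) ∂P =
        Complex.exp (-(u ^ 2 * ‖Y‖ ^ 2 / 2 : ℝ))} := by
    ext Y; rw [Set.mem_iInter]; rfl
  rw [this]
  exact isClosed_iInter fun u => isClosed_eq (continuous_integral_exp_mul_I u)
    (by fun_prop)

theorem map_eq_gaussianReal_iff_mem_centeredGaussianSet [IsProbabilityMeasure P] (Y : Lp ℝ 2 P) :
    P.map Y = gaussianReal 0 (‖Y‖ ^ 2).toNNReal ↔ Y ∈ centeredGaussianSet P := by
  have hY : AEMeasurable Y P := (Lp.stronglyMeasurable Y).measurable.aemeasurable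
  have h1 : ∀ u : ℝ, charFun (P.map Y) u = ∫ ω, Complex.exp ((u * Y ω : ℝ) * Complex.I) ∂P := by
    intro u
    rw [charFun_apply_real, integral_map hY (by fun_prop)]
    simp only [Complex.ofReal_mul]
  have h2 : ∀ u : ℝ, charFun (gaussianReal 0 (‖Y‖ ^ 2).toNNReal) u =
      Complex.exp (-(u ^ 2 * ‖Y‖ ^ 2 / 2 : ℝ)) := by
    intro u
    rw [charFun_gaussianReal]
    congr 1
    rw [Real.coe_toNNReal _ (by positivity)]
    push_cast; ring
  have := Measure.isProbabilityMeasure_map (μ := P) hY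
  constructor
  · intro h u
    rw [← h1, h, h2]
  · intro h
    refine Measure.ext_of_charFun (funext fun u => ?_)
    rw [h1, h2]; exact h u

end GaussianSpace

section GaussianProcess

variable {d : ℕ} {Ω : Type*} [MeasurableSpace Ω] {P : Measure Ω} {ζ : Cube d → Ω → ℝ}

namespace IsCenteredGaussianL2

theorem span_subset_centeredGaussianSet [IsProbabilityMeasure P]
    (hζ : IsCenteredGaussianL2 P ζ) :
    (Submodule.span ℝ (Set.range fun t => (hζ.memLp_eval t).toLp (ζ t)) : Set (Lp ℝ 2 P)) ⊆
      centeredGaussianSet P := by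
  intro Y hY
  obtain ⟨c, rfl⟩ := Finsupp.mem_span_range_iff_exists_finsupp.1 hY
  set Y := c.sum fun t a => a • (hζ.memLp_eval t).toLp (ζ t) with hYdef
  have hae : Y =ᵐ[P] fun ω => ∑ t ∈ c.support, c t • ζ t ω := by
    rw [hYdef, Finsupp.sum]
    refine (Lp.coeFn_finsetSum _ _).trans ?_
    have : ∀ t ∈ c.support, (c t • (hζ.memLp_eval t).toLp (ζ t) : Lp ℝ 2 P) =ᵐ[P] c t • ζ t := by
      intro t _
      refine (Lp.coeFn_smul _ _).trans ?_
      filter_upwards [(hζ.memLp_eval t).coeFn_toLp] with ω hω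
      simp [hω]
    filter_upwards [(Filter.eventually_all_finset c.support).2 this] with ω hω
    rw [Finset.sum_apply]
    exact Finset.sum_congr rfl fun t ht => hω t ht
  have hG : HasGaussianLaw Y P :=
    ((hζ.gaussian.smul c).hasGaussianLaw_fun_sum (I := c.support)).congr hae.symm
  have h0 : ∫ ω, Y ω ∂P = 0 := by
    rw [integral_congr_ae hae, integral_finsetSum]
    · refine Finset.sum_eq_zero fun t _ => ?_
      simp only [smul_eq_mul]
      rw [integral_const_mul, hζ.centered t, mul_zero]
    · exact fun t _ => ((hζ.memLp_eval t).integrable (by norm_num)).smul (c t)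
  rw [← map_eq_gaussianReal_iff_mem_centeredGaussianSet, hasLaw_gaussianReal_of_centered hG h0,
    ← real_inner_self_eq_norm_sq, L2.inner_def]
  simp only [real_inner_eq_product, sq]

/-- A variable orthogonal to every `ζ t` is orthogonal to `∫ ζ h` by Fubini. So the pairing lies in
the closed span of the process, which consists of centered Gaussians because that class is closed in
`L²(P)`. -/
theorem pairing_mem_centeredGaussianSet [IsProbabilityMeasure P] (hζ : IsCenteredGaussianL2 P ζ)
    (h : CubeL2 d) : hζ.pairing h ∈ centeredGaussianSet P := by
  set W := Submodule.span ℝ (Set.range fun t => (hζ.memLp_eval t).toLp (ζ t)) with hW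
  have hsub : (W.topologicalClosure : Set (Lp ℝ 2 P)) ⊆ centeredGaussianSet P := by
    rw [Submodule.topologicalClosure_coe]
    exact closure_minimal hζ.span_subset_centeredGaussianSet isClosed_centeredGaussianSet
  refine hsub ?_
  rw [SetLike.mem_coe, ← Submodule.orthogonal_orthogonal_eq_closure, Submodule.mem_orthogonal]
  intro Y hY
  have hYt : ∀ t, ∫ ω, Y ω * ζ t ω ∂P = 0 := by
    intro t
    have h1 := Submodule.inner_left_of_mem_orthogonal
      (Submodule.subset_span (Set.mem_range_self t) : (hζ.memLp_eval t).toLp (ζ t) ∈ W) hY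
    rw [L2.inner_def] at h1
    rw [← h1]
    refine integral_congr_ae ?_
    filter_upwards [(hζ.memLp_eval t).coeFn_toLp] with ω hω
    rw [hω, real_inner_eq_product]
  rw [L2.inner_def]
  have h2 := hζ.integral_mul_pathIntegral h (Lp.memLp Y)
  simp only [hYt, mul_zero, integral_zero] at h2
  rw [← h2]
  refine integral_congr_ae ?_
  filter_upwards [hζ.coeFn_pairing h] with ω hω
  rw [hω, real_inner_eq_product]

theorem map_pathIntegral [IsProbabilityMeasure P] (hζ : IsCenteredGaussianL2 P ζ) (h : CubeL2 d) :
    P.map (pathIntegral ζ h) = gaussianReal 0 (‖hζ.pairing h‖ ^ 2).toNNReal := by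
  rw [← Measure.map_congr (hζ.coeFn_pairing h)]
  exact (map_eq_gaussianReal_iff_mem_centeredGaussianSet _).2 (hζ.pairing_mem_centeredGaussianSet h)

theorem hasGaussianLaw_pathIntegral [IsProbabilityMeasure P] (hζ : IsCenteredGaussianL2 P ζ)
    {ι : Type*} [Fintype ι] (v : ι → CubeL2 d) :
    HasGaussianLaw (fun ω i => pathIntegral ζ (v i) ω) P := by
  classical
  have hm : Measurable fun ω i => pathIntegral ζ (v i) ω :=
    measurable_pi_lambda _ fun i => measurable_pathIntegral hζ.measurable (v i)
  refine ⟨isGaussian_of_map_eq_gaussianReal fun L => ?_⟩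
  rw [Measure.map_map (by fun_prop) hm]
  -- Cramér–Wold: a linear combination of pairings is the pairing with the same combination of the
  -- `v i`, hence Gaussian.
  refine ⟨0, (‖hζ.pairing (∑ i, L (Pi.single i 1) • v i)‖ ^ 2).toNNReal, ?_⟩
  rw [← hζ.map_pathIntegral]
  refine Measure.map_congr ?_
  filter_upwards [hζ.ae_pathIntegral_linear] with ω ⟨x, _, hx⟩
  rw [Function.comp_apply, hx, inner_sum]
  simp only [← hx]
  rw [← L.coe_coe, LinearMap.pi_apply_eq_sum_univ]
  refine Finset.sum_congr rfl fun i _ => ?_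
  rw [smul_eq_mul, mul_comm]
  rw [hx, hx, real_inner_smul_right, L.coe_coe]
  congr 2
  funext j
  simp [Pi.single_apply, eq_comm]

theorem integral_pathIntegral [IsProbabilityMeasure P] (hζ : IsCenteredGaussianL2 P ζ)
    (h : CubeL2 d) : ∫ ω, pathIntegral ζ h ω ∂P = 0 := by
  have := integral_map (μ := P) (measurable_pathIntegral hζ.measurable h).aemeasurable
    (f := fun x : ℝ => x) (by fun_prop)
  rw [← this, hζ.map_pathIntegral, integral_id_gaussianReal]

end IsCenteredGaussianL2

end GaussianProcess

/-! ### The Laplace transform of the squared norm -/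

theorem integral_exp_neg_mul_sq_gaussianReal {s : ℝ} (hs : 0 < s) (v : NNReal) :
    ∫ x, Real.exp (-(s * x ^ 2)) ∂gaussianReal 0 v =
      Real.exp (-(1 / 2) * Real.log (1 + 2 * s * v)) := by
  have hpos : 0 < 1 + 2 * s * v := by positivity
  rw [show -(1 / 2) * Real.log (1 + 2 * s * v) = Real.log (1 + 2 * s * v) * (-(1 / 2)) by ring,
    ← Real.rpow_def_of_pos hpos, Real.rpow_neg hpos.le, ← Real.sqrt_eq_rpow]
  by_cases hv : v = 0
  · simp [hv]
  have hv0 : (0 : ℝ) < v := by positivity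
  rw [integral_gaussianReal_eq_integral_smul hv]
  have h1 : ∀ x : ℝ, gaussianPDFReal 0 v x • Real.exp (-(s * x ^ 2)) =
      (√(2 * Real.pi * v))⁻¹ * Real.exp (-((1 + 2 * s * v) / (2 * v)) * x ^ 2) := by
    intro x
    rw [gaussianPDFReal, smul_eq_mul, mul_assoc, ← Real.exp_add]
    congr 2
    field_simp
    ring
  simp only [h1]
  rw [integral_const_mul, integral_gaussian, ← Real.sqrt_inv, ← Real.sqrt_inv,
    ← Real.sqrt_mul (by positivity)]
  congr 1
  field_simp

section GaussianProcess

variable {d : ℕ} {Ω : Type*} [MeasurableSpace Ω] {P : Measure Ω} {ζ : Cube d → Ω → ℝ}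

namespace IsCenteredGaussianL2

/-- Jointly Gaussian and uncorrelated coordinates are independent, so the expectation factors. -/
theorem integral_exp_neg_finset_sum [IsProbabilityMeasure P] (hζ : IsCenteredGaussianL2 P ζ)
    {ι : Type*} {v : ι → CubeL2 d} {a : ι → ℝ} (ha : ∀ i, ‖hζ.pairing (v i)‖ ^ 2 = a i)
    (horth : ∀ i j, i ≠ j → inner ℝ (hζ.pairing (v i)) (hζ.pairing (v j)) = 0)
    {s : ℝ} (hs : 0 < s) (F : Finset ι) :
    ∫ ω, Real.exp (-(s * ∑ i ∈ F, pathIntegral ζ (v i) ω ^ 2)) ∂P =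
      Real.exp (-(1 / 2) * ∑ i ∈ F, Real.log (1 + 2 * s * a i)) := by
  have hG := hζ.hasGaussianLaw_pathIntegral fun i : F => v i
  have hind : iIndepFun (fun (i : F) ω => pathIntegral ζ (v i) ω) P := by
    refine hG.iIndepFun_of_covariance_eq_zero fun i j hij => ?_
    rw [covariance_eq_sub (hζ.memLp_pathIntegral _) (hζ.memLp_pathIntegral _),
      hζ.integral_pathIntegral, zero_mul, sub_zero]
    have := horth i j fun h => hij (Subtype.ext h)
    rwa [hζ.inner_pairing] at this
  have hm := fun i : F => (measurable_pathIntegral hζ.measurable (v i)).aemeasurable (μ := P)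
  have hf : Continuous fun x : ℝ => Real.exp (-(s * x ^ 2)) := by fun_prop
  have hprod := hind.integral_fun_prod_comp (f := fun _ x => Real.exp (-(s * x ^ 2))) hm
    fun i => hf.aestronglyMeasurable
  have e1 : ∀ ω, Real.exp (-(s * ∑ i ∈ F, pathIntegral ζ (v i) ω ^ 2)) =
      ∏ i : F, Real.exp (-(s * pathIntegral ζ (v i) ω ^ 2)) := by
    intro ω
    rw [← Real.exp_sum, Finset.sum_coe_sort F fun i => -(s * pathIntegral ζ (v i) ω ^ 2),
      Finset.sum_neg_distrib, Finset.mul_sum]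
  simp only [e1]
  rw [hprod, Finset.mul_sum, Real.exp_sum,
    ← Finset.prod_coe_sort F fun i => Real.exp (-(1 / 2) * Real.log (1 + 2 * s * a i))]
  refine Finset.prod_congr rfl fun i _ => ?_
  have := integral_map (hm i) (f := fun x : ℝ => Real.exp (-(s * x ^ 2)))
    hf.aestronglyMeasurable
  rw [← this, hζ.map_pathIntegral, integral_exp_neg_mul_sq_gaussianReal hs,
    Real.coe_toNNReal _ (by positivity), ha]

theorem integral_exp_neg_pathNorm_sq [IsProbabilityMeasure P] (hζ : IsCenteredGaussianL2 P ζ)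
    {ι : Type*} [Countable ι] (b : HilbertBasis ι ℝ (CubeL2 d)) {a : ι → ℝ}
    (ha : ∀ i, ‖hζ.pairing (b i)‖ ^ 2 = a i)
    (horth : ∀ i j, i ≠ j → inner ℝ (hζ.pairing (b i)) (hζ.pairing (b j)) = 0)
    {s : ℝ} (hs : 0 < s) :
    ∫ ω, Real.exp (-(s * (pathNorm ζ ω).toReal ^ 2)) ∂P =
      Real.exp (-(1 / 2) * ∑' i, Real.log (1 + 2 * s * a i)) := by
  have ha0 : ∀ i, 0 ≤ a i := fun i => ha i ▸ sq_nonneg _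
  have hsum : Summable a := by simpa only [ha] using hζ.summable_norm_sq_pairing b
  have hlog : Summable fun i => Real.log (1 + 2 * s * a i) := by
    refine Summable.of_nonneg_of_le (fun i => ?_) (fun i => ?_) (hsum.mul_left (2 * s))
    · exact Real.log_nonneg (by nlinarith [mul_nonneg hs.le (ha0 i)])
    · have := mul_nonneg hs.le (ha0 i)
      have := Real.log_le_sub_one_of_pos (show 0 < 1 + 2 * s * a i by nlinarith)
      linarith
  have h1 : Filter.Tendsto (fun F : Finset ι => ∫ ω, Real.exp (-(s * ∑ i ∈ F, pathIntegral ζ (b i)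
      ω ^ 2)) ∂P)
      Filter.atTop (nhds (∫ ω, Real.exp (-(s * (pathNorm ζ ω).toReal ^ 2)) ∂P)) := by
    -- Dominated convergence needs a countably generated filter; countability of `ι` provides this
    -- for `atTop` on `Finset ι`.
    refine tendsto_integral_filter_of_dominated_convergence (fun _ => 1)
      (Filter.Eventually.of_forall fun F => ?_) (Filter.Eventually.of_forall fun F => ?_)
      (integrable_const 1) ?_
    · have hm := fun i => measurable_pathIntegral hζ.measurable (b i)
      exact Measurable.aestronglyMeasurable (by fun_prop)
    · refine ae_of_all _ fun ω => ?_
      rw [Real.norm_of_nonneg (Real.exp_nonneg _), Real.exp_le_one_iff, neg_nonpos]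
      positivity
    · filter_upwards [hζ.ae_hasSum_sq_pathIntegral b] with ω hω
      exact (Real.continuous_exp.tendsto _).comp (Filter.Tendsto.neg
          (Filter.Tendsto.const_mul s hω))
  have h2 : Filter.Tendsto (fun F : Finset ι => Real.exp (-(1 / 2) * ∑ i ∈ F, Real.log
      (1 + 2 * s * a i)))
      Filter.atTop (nhds (Real.exp (-(1 / 2) * ∑' i, Real.log (1 + 2 * s * a i)))) :=
    (Real.continuous_exp.tendsto _).comp (Filter.Tendsto.const_mul _ hlog.hasSum)
  simp only [hζ.integral_exp_neg_finset_sum ha horth hs] at h1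
  exact tendsto_nhds_unique h1 h2

/-- The Karhunen–Loève spectrum of the process: it gives the eigenvalues of the covariance
operator and the Laplace transform of the squared norm of the paths. -/
theorem exists_spectrum [IsProbabilityMeasure P] (hζ : IsCenteredGaussianL2 P ζ) :
    ∃ (ι : Type) (a : ι → ℝ), (∀ i, 0 ≤ a i) ∧ Summable a ∧
      (∀ k, klEigenvalue (covKernel P ζ) k = sortedTerm a k) ∧
      ∀ s : ℝ, 0 < s → ∫ ω, Real.exp (-(s * (pathNorm ζ ω).toReal ^ 2)) ∂P =
        Real.exp (-(1 / 2) * ∑' i, Real.log (1 + 2 * s * a i)) := by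
  obtain ⟨ι, b, a, hab⟩ :=
    exists_hilbertBasis_eigenvectors hζ.isCompactOperator_covOp hζ.isSymmetric_covOp
  have : Fact ((2 : ENNReal) ≠ ⊤) := ⟨by norm_num⟩
  have : IsSeparable (volume : Measure (Cube d)) := isSeparable_of_sigmaFinite _
  have hc : Countable ι := countable_of_orthonormal b.orthonormal
  -- In the eigenbasis the coordinates become uncorrelated, with variances `a i`; this also gives `0
  -- ≤ a i`.
  have hinner : ∀ i j, inner ℝ (hζ.pairing (b i)) (hζ.pairing (b j)) = a j * inner ℝ (b i) (b j) :=
      by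
    intro i j
    rw [← hζ.inner_covOp, hab, real_inner_smul_right]
  have ha : ∀ i, ‖hζ.pairing (b i)‖ ^ 2 = a i := by
    intro i
    rw [← real_inner_self_eq_norm_sq, hinner, real_inner_self_eq_norm_sq, b.orthonormal.1 i]
    simp
  have horth : ∀ i j, i ≠ j → inner ℝ (hζ.pairing (b i)) (hζ.pairing (b j)) = 0 := by
    intro i j hij
    rw [hinner, b.orthonormal.2 hij, mul_zero]
  have ha0 : ∀ i, 0 ≤ a i := fun i => ha i ▸ sq_nonneg _
  have hsum : Summable a := by simpa only [ha] using hζ.summable_norm_sq_pairing b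
  refine ⟨ι, a, ha0, hsum, fun k => ?_, fun s hs => hζ.integral_exp_neg_pathNorm_sq b ha horth hs⟩
  rw [klEigenvalue, sortedTerm]
  congr 1
  ext x
  refine and_congr_right fun hx => ?_
  simp only [hζ.fredholmEigen_iff]
  exact exists_linearIndependent_eigenvectors_iff hζ.isSymmetric_covOp b hab
    (finite_setOf_le_of_summable hsum hx) k

end IsCenteredGaussianL2

end GaussianProcess

/-! ### From the Laplace transform to the law, and the conclusion -/

theorem integral_pow_map_exp_neg_sq {Ω : Type*} [MeasurableSpace Ω] (P : Measure Ω)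
    {X : Ω → ENNReal} (hX : Measurable X) (n : ℕ) :
    ∫ x, x ^ n ∂(P.map fun ω => Real.exp (-((X ω).toReal ^ 2))) =
      ∫ ω, Real.exp (-((n : ℝ) * (X ω).toReal ^ 2)) ∂P := by
  have hf : Measurable fun ω => Real.exp (-((X ω).toReal ^ 2)) := by fun_prop
  rw [integral_map hf.aemeasurable (by fun_prop)]
  refine integral_congr_ae (ae_of_all _ fun ω => ?_)
  simp only
  rw [← Real.exp_nat_mul]
  congr 1; ring

/-- Nonnegative extended random variables, almost surely finite, with the same Laplace transform
of their square have the same law. -/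
theorem identDistrib_of_integral_exp_neg_eq {Ω₁ Ω₂ : Type*} [MeasurableSpace Ω₁]
    [MeasurableSpace Ω₂] {P₁ : Measure Ω₁} [IsProbabilityMeasure P₁] {P₂ : Measure Ω₂}
    [IsProbabilityMeasure P₂] {X : Ω₁ → ENNReal} {Y : Ω₂ → ENNReal} (hX : Measurable X)
    (hY : Measurable Y) (hXf : ∀ᵐ ω ∂P₁, X ω < ⊤) (hYf : ∀ᵐ ω ∂P₂, Y ω < ⊤)
    (h : ∀ s : ℝ, 0 < s → ∫ ω, Real.exp (-(s * (X ω).toReal ^ 2)) ∂P₁ =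
      ∫ ω, Real.exp (-(s * (Y ω).toReal ^ 2)) ∂P₂) : IdentDistrib X Y P₁ P₂ := by
  have hf : Measurable fun x : ENNReal => Real.exp (-(x.toReal ^ 2)) := by fun_prop
  have hmem : ∀ x : ENNReal, Real.exp (-(x.toReal ^ 2)) ∈ Set.Icc (0 : ℝ) 1 := fun x =>
    ⟨Real.exp_nonneg _, Real.exp_le_one_iff.2 (neg_nonpos.2 (sq_nonneg _))⟩
  have hX' := (hf.comp hX).aemeasurable (μ := P₁)
  have hY' := (hf.comp hY).aemeasurable (μ := P₂)
  have hid : IdentDistrib (fun ω => Real.exp (-((X ω).toReal ^ 2)))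
      (fun ω => Real.exp (-((Y ω).toReal ^ 2))) P₁ P₂ := by
    refine ⟨hX', hY', ?_⟩
    have := Measure.isProbabilityMeasure_map hX'
    have := Measure.isProbabilityMeasure_map hY'
    refine measure_ext_of_moments ?_ ?_ fun n => ?_
    · exact (ae_map_iff hX' measurableSet_Icc).2 (ae_of_all _ fun ω => hmem _)
    · exact (ae_map_iff hY' measurableSet_Icc).2 (ae_of_all _ fun ω => hmem _)
    · refine (integral_pow_map_exp_neg_sq P₁ hX n).trans (Eq.trans ?_
          (integral_pow_map_exp_neg_sq P₂ hY n).symm)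
      -- The hypothesis covers only `s > 0`; the zeroth moments are both the total mass `1`.
      rcases Nat.eq_zero_or_pos n with rfl | hn
      · simp
      · exact h n (by exact_mod_cast hn)
  have hg : Measurable fun y : ℝ => ENNReal.ofReal (Real.sqrt (-Real.log y)) := by fun_prop
  -- Finiteness is essential: `toReal` sends `⊤` to `0`, so the transformation confuses the two
  -- values.
  have hinv : ∀ x : ENNReal, x < ⊤ →
      ENNReal.ofReal (Real.sqrt (-Real.log (Real.exp (-(x.toReal ^ 2))))) = x := by
    intro x hx
    rw [Real.log_exp, neg_neg, Real.sqrt_sq ENNReal.toReal_nonneg, ENNReal.ofReal_toReal hx.ne]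
  have e1 : X =ᵐ[P₁] fun ω => ENNReal.ofReal (Real.sqrt (-Real.log (Real.exp
      (-((X ω).toReal ^ 2))))) := by
    filter_upwards [hXf] with ω hω using (hinv _ hω).symm
  have e2 : (fun ω => ENNReal.ofReal (Real.sqrt (-Real.log (Real.exp (-((Y ω).toReal ^ 2))))))
      =ᵐ[P₂] Y := by
    filter_upwards [hYf] with ω hω using hinv _ hω
  exact ((IdentDistrib.of_ae_eq hX.aemeasurable e1).trans (hid.comp hg)).trans
    (IdentDistrib.of_ae_eq (hY.aemeasurable.congr e2.symm) e2)

theorem theorem1p2 {d : ℕ} (hd : 1 ≤ d)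
    {Ω₁ Ω₂ : Type*} [MeasurableSpace Ω₁] [MeasurableSpace Ω₂]
    (P₁ : Measure Ω₁) [IsProbabilityMeasure P₁] (P₂ : Measure Ω₂) [IsProbabilityMeasure P₂]
    (ζ₁ : Cube d → Ω₁ → ℝ) (ζ₂ : Cube d → Ω₂ → ℝ)
    (h₁ : IsCenteredGaussianL2 P₁ ζ₁) (h₂ : IsCenteredGaussianL2 P₂ ζ₂) :
    QuadEq P₁ P₂ ζ₁ ζ₂ ↔
      ∀ k : ℕ, 1 ≤ k → klEigenvalue (covKernel P₁ ζ₁) k = klEigenvalue (covKernel P₂ ζ₂) k := by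
  obtain ⟨ι, a, ha, hsa, hka, hLa⟩ := h₁.exists_spectrum
  obtain ⟨κ, b, hb, hsb, hkb, hLb⟩ := h₂.exists_spectrum
  constructor
  · intro h k hk
    have hlog : ∀ s : ℝ, 0 < s →
        ∑' i, Real.log (1 + s * a i) = ∑' j, Real.log (1 + s * b j) := by
      intro s hs
      -- The parameter `s / 2` absorbs the factor `2` in `log (1 + 2 s aᵢ)`.
      have hm : Measurable fun x : ENNReal => Real.exp (-(s / 2 * x.toReal ^ 2)) := by fun_prop
      have := (IdentDistrib.comp h hm).integral_eq
      simp only [Function.comp_def] at this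
      rw [hLa _ (half_pos hs), hLb _ (half_pos hs), mul_div_cancel₀ s two_ne_zero] at this
      have := Real.exp_injective this
      linarith
    obtain ⟨e, he⟩ := exists_equiv_of_encard_eq hsa hsb
      fun x hx => encard_eq_of_tsum_log_eq ha hb hsa hsb hlog hx
    rw [hka, hkb, sortedTerm, sortedTerm]
    congr 1
    ext x
    exact and_congr_right fun hx => by rw [encard_le_eq_of_equiv e he hx]
  · intro h
    have hN : ∀ x : ℝ, 0 < x → {i | x ≤ a i}.encard = {j | x ≤ b j}.encard := fun x hx =>
      encard_le_eq_of_sortedTerm_eq ha hb hsa hsb (fun k hk => by rw [← hka, ← hkb, h k hk]) hx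
    obtain ⟨e, he⟩ := exists_equiv_of_encard_eq hsa hsb
      fun x hx => encard_eq_of_encard_le_eq hsa hsb hN hx
    refine identDistrib_of_integral_exp_neg_eq (measurable_pathNorm h₁.measurable)
      (measurable_pathNorm h₂.measurable) h₁.path_finite h₂.path_finite fun s hs => ?_
    rw [hLa s hs, hLb s hs,
      tsum_eq_of_equiv ha hb e he (fun x => Real.log (1 + 2 * s * x)) (by simp)]
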